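/- **Flipping coins.** A position is a finite line of coins, written as a $0$–$1$ string $d_1d_2\ldots d_n$ ($0$ = heads, $1$ = tails); all coins to the right of the rightmost $1$ are always deleted. A Left move chooses $i<j$ with $d_i=d_j=1$ and turns both into $0$. A Right move chooses $k<\ell$ with $d_k=0$, $d_\ell=1$ and turns over both, so that $d_k=1$, $d_\ell=0$. A player who cannot move loses. Equality of a position and a number is equality of combinatorial games, a dyadic rational being identified with its canonical form. The ordinal sum of games is $G:H=\{G^{\mathcal L},\,G:H^{\mathcal L}\mid G^{\mathcal R},\,G:H^{\mathcal R}\}$; for numbers $x,y$ (dyadic rationals), $x:y$ denotes the number equal to the ordinal sum of their canonical forms. **Algorithm.** Let $G$ be a position that contains at least one $1$, and let $G_0=G$. 1. *Reductions.* As long as one of the following cases applies, for some strings $\alpha,\beta$ (possibly empty), perform the replacement, in any order: (a) if $G_0=\alpha01^{3+j}\beta$ with $j\ge1$, replace $G_0$ by $\alpha101^{j}\beta$; (b) if $G_0=\alpha01^{3}\beta$ and $\beta$ contains an even number of $1$s, replace $G_0$ by $\alpha10\beta$ (by $\alpha1$ if $\beta$ is empty). 2. *Decomposition.* Starting with $i=0$: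 if $G_i$ is of the form $0^r1$ ($r\ge0$) or $1^a0^{p}10^{q}1$ ($a,p,q\ge0$), stop. Otherwise $G_i=\alpha01^a0^{p_i}10^{q_i}1$ with $a>0$ and $p_i+q_i\ge1$; put $G_{i+1}=\alpha01^a$, increase $i$ by one and repeat. 3. *Evaluation.* If the last string is $G_i=0^r1$, put $v_i=-r$; if it is $1^a0^{p}10^{q}1$, put $v_i=\lfloor a/2\rfloor+\dfrac1{2^{2p+q}}$. Then for $j=i-1,\ldots,0$ put $v_j=v_{j+1}:\dfrac{1}{2^{2p_j+q_j-1}}$, and return $v_0$. **Theorem (Value Theorem).** For every flipping coins position $G$ that contains at least one $1$, the algorithm is well defined and terminates, whatever the order in which the reductions are applied; it always returns the same number (dyadic rational) $v_0$, and $G=v_0$. -/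

import Mathlib

/-! ## Combinatorial games (normal play) -/

/-- A (partizan) combinatorial game `{L | R}`: a family of Left options and a family of Right
options, each option being a game again. -/
inductive CGame : Type 1
  | mk (l r : Type) (L : l → CGame) (R : r → CGame) : CGame

namespace CGame

/-- The index type of the Left options. -/
def LeftIdx : CGame → Type
  | mk l _ _ _ => l

/-- The index type of the Right options. -/
def RightIdx : CGame → Type
  | mk _ r _ _ => r

/-- The Left options. -/
def left : (G : CGame) → G.LeftIdx → CGame
  | mk _ _ L _ => L

/-- The Right options. -/
def right : (G : CGame) → G.RightIdx → CGame
  | mk _ _ _ R => R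

mutual

/-- Conway's order: `G ≤ H` if no Left option of `G` is `≥ H` and no Right option of `H`
is `≤ G` (see `le_iff`). -/
inductive Le : CGame → CGame → Prop
  | intro (G H : CGame) (hL : ∀ i, Lf (G.left i) H) (hR : ∀ j, Lf G (H.right j)) : Le G H

/-- `Lf G H` is the negation of `H ≤ G` (see `lf_iff_not_le`). -/
inductive Lf : CGame → CGame → Prop
  | ofLeft (G H : CGame) (i : H.LeftIdx) (h : Le G (H.left i)) : Lf G H
  | ofRight (G H : CGame) (j : G.RightIdx) (h : Le (G.right j) H) : Lf G H

end

theorem lf_iff_not_le_both (G : CGame) :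
    ∀ H : CGame, (Lf G H ↔ ¬ Le H G) ∧ (Lf H G ↔ ¬ Le G H) := by
  induction G with
  | mk gl gr gL gR ihGL ihGR =>
    intro H
    induction H with
    | mk hl hr hL hR ihHL ihHR =>
      constructor
      · constructor
        · rintro (⟨_, _, i, h⟩ | ⟨_, _, j, h⟩) ⟨_, _, h1, h2⟩
          · exact (ihHL i).2.1 (h1 i) h
          · exact (ihGR j _).2.1 (h2 j) h
        · intro h
          by_contra hn
          refine h (Le.intro _ _ (fun i => ?_) (fun j => ?_))
          · exact (ihHL i).2.2 (fun hh => hn (Lf.ofLeft _ _ i hh))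
          · exact (ihGR j _).2.2 (fun hh => hn (Lf.ofRight _ _ j hh))
      · constructor
        · rintro (⟨_, _, i, h⟩ | ⟨_, _, j, h⟩) ⟨_, _, h1, h2⟩
          · exact (ihGL i _).1.1 (h1 i) h
          · exact (ihHR j).1.1 (h2 j) h
        · intro h
          by_contra hn
          refine h (Le.intro _ _ (fun i => ?_) (fun j => ?_))
          · exact (ihGL i _).1.2 (fun hh => hn (Lf.ofLeft _ _ i hh))
          · exact (ihHR j).1.2 (fun hh => hn (Lf.ofRight _ _ j hh))

theorem lf_iff_not_le (G H : CGame) : Lf G H ↔ ¬ Le H G := (lf_iff_not_le_both G H).1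

theorem le_iff (G H : CGame) :
    Le G H ↔ (∀ i, ¬ Le H (G.left i)) ∧ ∀ j, ¬ Le (H.right j) G := by
  simp only [← lf_iff_not_le]
  exact ⟨fun ⟨_, _, h1, h2⟩ => ⟨h1, h2⟩, fun h => Le.intro _ _ h.1 h.2⟩

/-- Equality of games (equality of values): `G = H` if `G ≤ H` and `H ≤ G`. -/
def Equal (G H : CGame) : Prop := Le G H ∧ Le H G

/-- The ordinal sum `G : H = {G^L, G : H^L | G^R, G : H^R}`. -/
def ordinalSum (G : CGame) : CGame → CGame
  | mk l r L R =>
    mk (G.LeftIdx ⊕ l) (G.RightIdx ⊕ r)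
      (Sum.elim G.left fun i => ordinalSum G (L i))
      (Sum.elim G.right fun j => ordinalSum G (R j))

/-! ## Numbers -/

/-- The canonical form of the integer `n ≥ 0`: `0 = {|}` and `n + 1 = {n|}`. -/
def ofNat : ℕ → CGame
  | 0 => mk Empty Empty Empty.elim Empty.elim
  | n + 1 => mk Unit Empty (fun _ => ofNat n) Empty.elim

/-- The canonical form of the integer `-n ≤ 0`: `-0 = {|}` and `-(n + 1) = {|-n}`. -/
def negOfNat : ℕ → CGame
  | 0 => mk Empty Empty Empty.elim Empty.elim
  | n + 1 => mk Empty Unit Empty.elim (fun _ => negOfNat n)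

/-- The canonical form of an integer. -/
def ofInt : ℤ → CGame
  | Int.ofNat n => ofNat n
  | Int.negSucc n => negOfNat (n + 1)

/-- The canonical form of `p / 2 ^ q`: for `p` odd and `q ≥ 1` it is
`{(p - 1) / 2 ^ q | (p + 1) / 2 ^ q}`, both options in canonical form; an even `p` is
cancelled first. -/
def ofDyadic (p : ℤ) : ℕ → CGame
  | 0 => ofInt p
  | q + 1 =>
    if Even p then ofDyadic (p / 2) q
    else mk Unit Unit (fun _ => ofDyadic ((p - 1) / 2) q) (fun _ => ofDyadic ((p + 1) / 2) q)

/-- Dyadic rationals: the denominator in lowest terms is a power of two. -/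
def IsDyadic (x : ℚ) : Prop := ∃ q : ℕ, x.den = 2 ^ q

/-- The canonical form of a dyadic rational `x` (only used for dyadic `x`). -/
def ofRat (x : ℚ) : CGame := ofDyadic x.num (Nat.log 2 x.den)

/-- `G = x`: the game `G` is equal to the number (dyadic rational) `x`. -/
def HasValue (G : CGame) (x : ℚ) : Prop := IsDyadic x ∧ Equal G (ofRat x)

/-- For numbers `x`, `y`, `z`: `z = x : y`, the ordinal sum of the numbers `x` and `y`, i.e. the
ordinal sum of their canonical forms has value `z`. -/
def IsOrdinalSum (z x y : ℚ) : Prop := HasValue (ordinalSum (ofRat x) (ofRat y)) z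

end CGame

/-! ## Flipping coins -/

namespace FlippingCoins

/-- A line of coins `d₁ d₂ … dₙ`; heads (`0`) is `false` and tails (`1`) is `true`. -/
abbrev Line : Type := List Bool

/-- `0 ^ n` -/
abbrev zeros (n : ℕ) : Line := List.replicate n false

/-- `1 ^ n` -/
abbrev ones (n : ℕ) : Line := List.replicate n true

/-- Delete all coins to the right of the rightmost `1`. -/
def trim (G : Line) : Line := G.rdropWhile (fun d => !d)

/-- Positions are the lines without superfluous heads at the right end. -/
def IsPosition (G : Line) : Prop := trim G = G

/-- The associated binary number `∑ dᵢ 2 ^ (i - 1)`. -/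
def binary : Line → ℕ
  | [] => 0
  | d :: G => d.toNat + 2 * binary G

/-- Left's moves: pairs `i < j` with `d_i = d_j = 1` (indices start at `0` here). -/
def LeftMove (G : Line) : Type :=
  {m : ℕ × ℕ // m.1 < m.2 ∧ G[m.1]? = some true ∧ G[m.2]? = some true}

/-- Right's moves: pairs `k < l` with `d_k = 0` and `d_l = 1`. -/
def RightMove (G : Line) : Type :=
  {m : ℕ × ℕ // m.1 < m.2 ∧ G[m.1]? = some false ∧ G[m.2]? = some true}

/-- The line after a move of Left. -/
def playLeft (G : Line) (m : LeftMove G) : Line :=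
  trim ((G.set m.1.1 false).set m.1.2 false)

/-- The line after a move of Right. -/
def playRight (G : Line) (m : RightMove G) : Line :=
  trim ((G.set m.1.1 true).set m.1.2 false)

theorem binary_append (G H : Line) : binary (G ++ H) = binary G + 2 ^ G.length * binary H := by
  induction G with
  | nil => simp [binary]
  | cons d G ih => simp only [List.cons_append, binary, ih, List.length_cons, pow_succ]; ring

theorem binary_trim (G : Line) : binary (trim G) = binary G := by
  induction G using List.reverseRecOn with
  | nil => simp [trim]
  | append_singleton G d ih =>
    cases d
    · rw [trim, List.rdropWhile_concat_pos _ _ _ (by simp), ← trim, ih, binary_append]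
      simp [binary]
    · rw [trim, List.rdropWhile_concat_neg _ _ _ (by simp)]

theorem binary_set (G : Line) (i : ℕ) (b c : Bool) (h : G[i]? = some b) :
    binary (G.set i c) + b.toNat * 2 ^ i = binary G + c.toNat * 2 ^ i := by
  induction G generalizing i with
  | nil => simp at h
  | cons d G ih =>
    cases i with
    | zero =>
      simp only [List.getElem?_cons_zero, Option.some.injEq] at h
      simp only [List.set_cons_zero, binary, h]
      ring
    | succ i =>
      simp only [List.getElem?_cons_succ] at h
      have := ih i h
      simp only [List.set_cons_succ, binary, pow_succ]
      linarith

theorem binary_playLeft_lt (G : Line) (m : LeftMove G) : binary (playLeft G m) < binary G := by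
  obtain ⟨⟨i, j⟩, hij, hi, hj⟩ := m
  dsimp only at hij hi hj
  have h1 := binary_set G i true false hi
  have hj' : (G.set i false)[j]? = some true := by
    rw [List.getElem?_set_ne hij.ne]; exact hj
  have h2 := binary_set (G.set i false) j true false hj'
  simp only [playLeft, binary_trim]
  simp only [Bool.toNat_true, Bool.toNat_false, one_mul, zero_mul, add_zero] at h1 h2
  have := Nat.two_pow_pos i
  have := Nat.two_pow_pos j
  omega

theorem binary_playRight_lt (G : Line) (m : RightMove G) : binary (playRight G m) < binary G := by
  obtain ⟨⟨i, j⟩, hij, hi, hj⟩ := m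
  dsimp only at hij hi hj
  have h1 := binary_set G i false true hi
  have hj' : (G.set i true)[j]? = some true := by
    rw [List.getElem?_set_ne hij.ne]; exact hj
  have h2 := binary_set (G.set i true) j true false hj'
  simp only [playRight, binary_trim]
  simp only [Bool.toNat_true, Bool.toNat_false, one_mul, zero_mul, add_zero] at h1 h2
  have : 2 ^ i < 2 ^ j := Nat.pow_lt_pow_right (by norm_num) hij
  omega

/-- The combinatorial game of flipping coins played from the line `G`. -/
def game (G : Line) : CGame :=
  CGame.mk (LeftMove G) (RightMove G)
    (fun m => game (playLeft G m)) (fun m => game (playRight G m))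
termination_by binary G
decreasing_by
  · exact binary_playLeft_lt G m
  · exact binary_playRight_lt G m

/-! ## The algorithm -/

/-- One application of a reduction: `α 0 1^(3+j) β ↦ α 1 0 1^j β` for `j ≥ 1`, or
`α 0 1^3 β ↦ α 1 0 β` when `β` contains an even number of `1`s. (If `β` is empty, the head at
the right end is deleted, as always.) -/
inductive Reduces : Line → Line → Prop
  | long (α β : Line) (j : ℕ) (hj : 1 ≤ j) :
      Reduces (α ++ [false] ++ ones (3 + j) ++ β) (α ++ [true, false] ++ ones j ++ β)
  | short (α β : Line) (hβ : Even (β.count true)) :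
      Reduces (α ++ [false] ++ ones 3 ++ β) (trim (α ++ [true, false] ++ β))

/-- `H` is a possible outcome of the reduction phase started from `G`: reductions are applied, in
any order, until none applies. -/
def ReducesFully (G H : Line) : Prop :=
  Relation.ReflTransGen Reduces G H ∧ ¬ ∃ K, Reduces H K

/-- The second phase of the algorithm. `Evaluates G v`: applied to `G`, it returns `v`.
On `0^r 1` it returns `-r`, on `1^a 0^p 1 0^q 1` it returns `⌊a / 2⌋ + 1 / 2^(2 p + q)`; otherwise
`G = α 0 1^a 0^p 1 0^q 1` with `a > 0` and `p + q ≥ 1` (i.e. `0^p 1 0^q 1` is what follows the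
third-last `1`), and it returns `v : 1 / 2^(2 p + q - 1)`, where `v` is what it returns on
`α 0 1^a`. The three forms exclude each other. -/
inductive Evaluates : Line → ℚ → Prop
  | oneTail (r : ℕ) : Evaluates (zeros r ++ [true]) (-(r : ℚ))
  | base (a p q : ℕ) :
      Evaluates (ones a ++ zeros p ++ [true] ++ zeros q ++ [true])
        (((a / 2 : ℕ) : ℚ) + 1 / 2 ^ (2 * p + q))
  | split (α : Line) (a p q : ℕ) (v w : ℚ) (ha : 0 < a) (hpq : 1 ≤ p + q)
      (hv : Evaluates (α ++ [false] ++ ones a) v)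
      (hw : CGame.IsOrdinalSum w v (1 / 2 ^ (2 * p + q - 1))) :
      Evaluates (α ++ [false] ++ ones a ++ zeros p ++ [true] ++ zeros q ++ [true]) w

/-- The algorithm, applied to `G`, terminates and returns `v`, whatever the order in which the
reductions are applied: there is no infinite sequence of reductions, and for every outcome of
the reduction phase the second phase returns `v` and nothing else. -/
def AlgorithmReturns (G : Line) (v : ℚ) : Prop :=
  Acc (fun K H => Reduces H K) G ∧
    ∀ H, ReducesFully G H → ∀ w, Evaluates H w ↔ w = v

end FlippingCoins

namespace CGame

theorem le_refl (G : CGame) : Le G G := by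
  induction G with
  | mk l r L R ihL ihR =>
    refine (le_iff _ _).2 ⟨fun i h => ?_, fun j h => ?_⟩
    · exact ((le_iff _ _).1 h).1 i (ihL i)
    · exact ((le_iff _ _).1 h).2 j (ihR j)

theorem not_le_left (G : CGame) (i : G.LeftIdx) : ¬ Le G (G.left i) :=
  ((le_iff _ _).1 (le_refl G)).1 i

theorem not_right_le (G : CGame) (j : G.RightIdx) : ¬ Le (G.right j) G :=
  ((le_iff _ _).1 (le_refl G)).2 j

theorem le_trans_of_options {G H K : CGame}
    (hL : ∀ i, Le H K → Le K (G.left i) → Le H (G.left i))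
    (hR : ∀ j, Le (K.right j) G → Le G H → Le (K.right j) H)
    (h₁ : Le G H) (h₂ : Le H K) : Le G K :=
  (le_iff _ _).2 ⟨fun i h => ((le_iff _ _).1 h₁).1 i (hL i h₂ h),
    fun j h => ((le_iff _ _).1 h₂).2 j (hR j h h₁)⟩

theorem le_trans_cyclic (G : CGame) : ∀ H K : CGame,
    (Le G H → Le H K → Le G K) ∧ (Le H K → Le K G → Le H G) ∧ (Le K G → Le G H → Le K H) := by
  induction G with
  | mk gl gr gL gR ihGL ihGR =>
    intro H
    induction H with
    | mk hl hr hL hR ihHL ihHR =>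
      intro K
      induction K with
      | mk kl kr kL kR ihKL ihKR =>
        exact ⟨le_trans_of_options (fun i => (ihGL i _ _).2.1) (fun j => (ihKR j).2.2),
          le_trans_of_options (fun i => (ihHL i _).2.2) (fun j => (ihGR j _ _).1),
          le_trans_of_options (fun i => (ihKL i).1) (fun j => (ihHR j _).2.1)⟩

theorem le_trans {G H K : CGame} (h₁ : Le G H) (h₂ : Le H K) : Le G K :=
  (le_trans_cyclic G H K).1 h₁ h₂

/-! ### Canonical forms of dyadic rationals -/

theorem den_dvd_of_mul_eq {x : ℚ} {q : ℕ} {p : ℤ} (h : x * 2 ^ q = p) : x.den ∣ 2 ^ q := by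
  have hx : x = Rat.divInt p (2 ^ q : ℕ) := by
    rw [Rat.divInt_eq_div]
    push_cast
    rw [← h]
    field_simp
  have hd : (x.den : ℤ) ∣ ((2 ^ q : ℕ) : ℤ) := hx ▸ Rat.den_dvd p _
  exact Int.natCast_dvd_natCast.1 hd

theorem isDyadic_of_mul_eq {x : ℚ} {q : ℕ} {p : ℤ} (h : x * 2 ^ q = p) : IsDyadic x :=
  let ⟨k, _, hk⟩ := (Nat.dvd_prime_pow Nat.prime_two).1 (den_dvd_of_mul_eq h)
  ⟨k, hk⟩

theorem one_div_two_pow_le_of_mul_eq {x : ℚ} {q : ℕ} {p : ℤ} (h : x * 2 ^ q = p) :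
    (1 : ℚ) / 2 ^ q ≤ 1 / x.den := by
  apply one_div_le_one_div_of_le
  · exact_mod_cast x.den_pos
  · exact_mod_cast Nat.le_of_dvd (by positivity) (den_dvd_of_mul_eq h)

theorem mul_two_pow_of_den {x : ℚ} {q : ℕ} (h : x.den = 2 ^ q) : x * 2 ^ q = x.num := by
  have := Rat.mul_den_eq_num x
  rw [h] at this
  exact_mod_cast this

theorem isDyadic_intCast (n : ℤ) : IsDyadic n := ⟨0, by simp⟩

theorem IsDyadic.add {x y : ℚ} (hx : IsDyadic x) (hy : IsDyadic y) : IsDyadic (x + y) := by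
  obtain ⟨a, ha⟩ := hx
  obtain ⟨b, hb⟩ := hy
  refine isDyadic_of_mul_eq (q := a + b) (p := x.num * 2 ^ b + y.num * 2 ^ a) ?_
  push_cast
  rw [← mul_two_pow_of_den ha, ← mul_two_pow_of_den hb]
  ring

theorem IsDyadic.neg {x : ℚ} (hx : IsDyadic x) : IsDyadic (-x) := hx

theorem IsDyadic.one_div_den {x : ℚ} (hx : IsDyadic x) : IsDyadic (1 / x.den) := by
  obtain ⟨q, hq⟩ := hx
  refine isDyadic_of_mul_eq (q := q) (p := 1) ?_
  rw [hq]
  push_cast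
  field_simp

theorem IsDyadic.sub_one_div_den {x : ℚ} (hx : IsDyadic x) : IsDyadic (x - 1 / x.den) := by
  rw [sub_eq_add_neg]
  exact hx.add hx.one_div_den.neg

theorem ne_intCast_of_den {x : ℚ} {q : ℕ} (hx : x.den = 2 ^ q) (hq : q ≠ 0) (n : ℤ) : x ≠ n := by
  rintro rfl
  rw [Rat.den_intCast] at hx
  exact (Nat.one_lt_two_pow hq).ne hx

theorem num_den_of_odd {p : ℤ} (hp : ¬ Even p) (q : ℕ) :
    ((p : ℚ) / 2 ^ q).num = p ∧ ((p : ℚ) / 2 ^ q).den = 2 ^ q := by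
  have hc : Nat.Coprime p.natAbs ((2 ^ q : ℤ)).natAbs := by
    rw [Int.natAbs_pow]
    exact Nat.Coprime.pow_right _
      (Nat.coprime_two_right.2 (Int.natAbs_odd.2 (Int.not_even_iff_odd.1 hp)))
  have h1 := Rat.num_div_eq_of_coprime (by positivity) hc
  have h2 := Rat.den_div_eq_of_coprime (by positivity) hc
  push_cast at h1 h2
  exact ⟨h1, by exact_mod_cast h2⟩

theorem ofDyadic_eq (q : ℕ) : ∀ p : ℤ, ofDyadic p q = ofRat (p / 2 ^ q) := by
  induction q with
  | zero => intro p; simp [ofRat, ofDyadic]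
  | succ q ih =>
    intro p
    by_cases hp : Even p
    · obtain ⟨k, rfl⟩ := hp
      have : (k + k) / 2 = k := by omega
      rw [ofDyadic, if_pos ⟨k, rfl⟩, this, ih]
      congr 1
      push_cast
      field_simp
      ring
    · obtain ⟨h₁, h₂⟩ := num_den_of_odd hp (q + 1)
      rw [ofRat, h₁, h₂, Nat.log_pow (by norm_num)]

theorem ofRat_intCast (n : ℤ) : ofRat n = ofInt n := by
  simp [ofRat, ofDyadic]

/-- The options of the canonical form of a dyadic rational. -/
theorem ofRat_options {x : ℚ} (hx : IsDyadic x) :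
    (∀ i, (ofRat x).left i = ofRat (x - 1 / x.den)) ∧
    (∀ j, (ofRat x).right j = ofRat (x + 1 / x.den)) ∧
    (Nonempty (ofRat x).LeftIdx ↔ ¬ ∃ n : ℕ, x = -n) ∧
    (Nonempty (ofRat x).RightIdx ↔ ¬ ∃ n : ℕ, x = n) := by
  obtain ⟨q, hq⟩ := hx
  have hxe := mul_two_pow_of_den hq
  cases q with
  | zero =>
    have hx : x = x.num := by simpa using hxe
    generalize x.num = m at hx
    subst hx
    rcases m with (_ | n) | n
    · have : ofRat ((Int.ofNat 0 : ℤ) : ℚ) = ofNat 0 := ofRat_intCast _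
      rw [this]
      refine ⟨fun i => i.elim, fun i => i.elim, ?_, ?_⟩
      · simp [ofNat, LeftIdx]
      · simpa [ofNat, RightIdx] using ⟨0, by simp⟩
    · have h₁ : ofRat ((Int.ofNat (n + 1) : ℤ) : ℚ) = ofNat (n + 1) := ofRat_intCast _
      have h₂ : ofRat ((n : ℤ) : ℚ) = ofNat n := ofRat_intCast _
      rw [h₁]
      refine ⟨fun i => ?_, fun i => i.elim, ?_, ?_⟩
      · refine h₂.symm.trans ?_
        congr 1
        simp
      · simp only [ofNat, LeftIdx, not_exists]
        refine ⟨fun _ => ?_, fun _ => ⟨()⟩⟩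
        intro k hk
        have : ((n : ℚ) + 1) = -k := by simpa using hk
        have : (n : ℚ) + 1 + k = 0 := by linarith
        exact absurd this (by positivity)
      · simp only [ofNat, RightIdx, not_nonempty_empty, false_iff, not_not]
        exact ⟨n + 1, by simp⟩
    · have h₁ : ofRat ((Int.negSucc n : ℤ) : ℚ) = negOfNat (n + 1) := ofRat_intCast _
      have h₂ : ofRat ((-n : ℤ) : ℚ) = negOfNat n := by
        rw [ofRat_intCast]
        cases n <;> rfl
      rw [h₁]
      refine ⟨fun i => i.elim, fun i => ?_, ?_, ?_⟩
      · refine h₂.symm.trans ?_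
        congr 1
        have : ((Int.negSucc n : ℤ) : ℚ).den = 1 := Rat.den_intCast _
        rw [this]
        push_cast [Int.negSucc_eq]
        ring
      · simp only [negOfNat, LeftIdx, not_nonempty_empty, false_iff, not_not]
        exact ⟨n + 1, by simp [Int.negSucc_eq]⟩
      · simp only [negOfNat, RightIdx, not_exists]
        refine ⟨fun _ => ?_, fun _ => ⟨()⟩⟩
        intro k hk
        have : -((n : ℚ) + 1) = k := by rw [← hk]; push_cast [Int.negSucc_eq]; ring
        have : (n : ℚ) + 1 + k = 0 := by linarith
        exact absurd this (by positivity)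
  | succ q =>
    have hodd : ¬ Even x.num := by
      intro he
      have h2 : 2 ∣ x.num.natAbs := Int.natCast_dvd.1 he.two_dvd
      have h3 : 2 ∣ x.den := by rw [hq]; exact Dvd.intro_left _ (pow_succ 2 q).symm
      have := Nat.dvd_gcd h2 h3
      rw [x.reduced] at this
      omega
    have h1 : ofRat x = mk Unit Unit (fun _ => ofDyadic ((x.num - 1) / 2) q)
        (fun _ => ofDyadic ((x.num + 1) / 2) q) := by
      rw [ofRat, hq, Nat.log_pow (by norm_num), ofDyadic, if_neg hodd]
    obtain ⟨k, hk⟩ := Int.not_even_iff_odd.1 hodd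
    have hnint := ne_intCast_of_den hq (by omega)
    have h2 : x * 2 ^ q = k + 1 / 2 := by
      rw [hk, pow_succ] at hxe
      push_cast at hxe
      linarith
    rw [h1]
    refine ⟨fun i => ?_, fun i => ?_, ?_, ?_⟩
    · refine (ofDyadic_eq q _).trans ?_
      have : (x.num - 1) / 2 = k := by omega
      rw [this, hq, show (k : ℚ) = x * 2 ^ q - 1 / 2 by linarith]
      congr 1
      push_cast
      field_simp
      ring
    · refine (ofDyadic_eq q _).trans ?_
      have : (x.num + 1) / 2 = k + 1 := by omega
      rw [this, hq]
      push_cast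
      rw [show (k : ℚ) = x * 2 ^ q - 1 / 2 by linarith]
      congr 1
      field_simp
      ring
    · simp only [LeftIdx, not_exists]
      refine ⟨fun _ => ?_, fun _ => ⟨()⟩⟩
      exact fun n hn => hnint (-n) (by simpa using hn)
    · simp only [RightIdx, not_exists]
      refine ⟨fun _ => ?_, fun _ => ⟨()⟩⟩
      exact fun n hn => hnint n (by simpa using hn)

theorem exists_option_between {x y : ℚ} (hx : IsDyadic x) (hy : IsDyadic y) (h : x < y) :
    ((¬ ∃ n : ℕ, y = -n) ∧ x ≤ y - 1 / y.den) ∨ ((¬ ∃ n : ℕ, x = n) ∧ x + 1 / x.den ≤ y) := by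
  obtain ⟨a, ha⟩ := hx
  obtain ⟨b, hb⟩ := hy
  have hxe := mul_two_pow_of_den ha
  have hye := mul_two_pow_of_den hb
  have key : ∀ c : ℕ, a ≤ c → b ≤ c → x + 1 / 2 ^ c ≤ y := by
    intro c hac hbc
    obtain ⟨d, rfl⟩ := Nat.exists_eq_add_of_le hac
    obtain ⟨e, he⟩ := Nat.exists_eq_add_of_le hbc
    have h1 : x * 2 ^ (a + d) = (x.num * 2 ^ d : ℤ) := by
      push_cast; rw [← hxe]; ring
    have h2 : y * 2 ^ (a + d) = (y.num * 2 ^ e : ℤ) := by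
      rw [he]; push_cast; rw [← hye]; ring
    have hpos : (0 : ℚ) < 2 ^ (a + d) := by positivity
    have h3 : x * 2 ^ (a + d) < y * 2 ^ (a + d) := by gcongr
    rw [h1, h2] at h3
    have h4 : (x.num * 2 ^ d : ℤ) + 1 ≤ y.num * 2 ^ e := by exact_mod_cast h3
    have h5 : x * 2 ^ (a + d) + 1 ≤ y * 2 ^ (a + d) := by
      rw [h1, h2]; exact_mod_cast h4
    have h6 : (x + 1 / 2 ^ (a + d)) * 2 ^ (a + d) ≤ y * 2 ^ (a + d) := by
      rw [add_mul, one_div, inv_mul_cancel₀ hpos.ne']; exact h5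
    exact le_of_mul_le_mul_right h6 hpos
  by_cases hb0 : b = 0
  · by_cases ha0 : a = 0
    · subst ha0 hb0
      have hk := key 0 le_rfl le_rfl
      simp only [pow_zero] at ha hb hk
      by_cases hy0 : 0 < y
      · left
        refine ⟨?_, by rw [hb]; push_cast; linarith⟩
        rintro ⟨n, rfl⟩
        have : (0 : ℚ) ≤ n := by positivity
        linarith
      · right
        refine ⟨?_, by rw [ha]; push_cast; linarith⟩
        rintro ⟨n, rfl⟩
        have : (0 : ℚ) ≤ n := by positivity
        linarith
    · right
      refine ⟨fun ⟨n, hn⟩ => ne_intCast_of_den ha ha0 n (by simpa using hn), ?_⟩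
      rw [ha]
      push_cast
      exact key a le_rfl (by omega)
  · by_cases hab : a ≤ b
    · left
      refine ⟨fun ⟨n, hn⟩ => ne_intCast_of_den hb hb0 (-n) (by simpa using hn), ?_⟩
      rw [hb]
      push_cast
      linarith [key b hab le_rfl]
    · right
      refine ⟨fun ⟨n, hn⟩ => ne_intCast_of_den ha (by omega) n (by simpa using hn), ?_⟩
      rw [ha]
      push_cast
      exact key a le_rfl (by omega)

theorem one_div_den_pos (x : ℚ) : 0 < 1 / (x.den : ℚ) :=
  one_div_pos.2 (by exact_mod_cast x.den_pos)

theorem le_and_not_le_of_eq_ofRat (G : CGame) : ∀ (H : CGame) (x y : ℚ), IsDyadic x → IsDyadic y →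
    G = ofRat x → H = ofRat y → (x ≤ y → Le G H) ∧ (x < y → ¬ Le H G) := by
  induction G with
  | mk gl gr gL gR ihGL ihGR =>
    intro H
    induction H with
    | mk hl hr hL hR ihHL ihHR =>
      intro x y hx hy hG hH
      obtain ⟨xl, xr, xln, xrn⟩ := ofRat_options hx
      obtain ⟨yl, yr, yln, yrn⟩ := ofRat_options hy
      rw [← hG] at xl xr xln xrn
      rw [← hH] at yl yr yln yrn
      have px := one_div_den_pos x
      have py := one_div_den_pos y
      constructor
      · intro h
        refine (le_iff _ _).2 ⟨fun i => ?_, fun j => ?_⟩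
        · exact (ihGL i _ _ y hx.sub_one_div_den hy (xl i) hH).2 (by linarith)
        · exact (ihHR j x _ hx (hy.add hy.one_div_den) hG (yr j)).2 (by linarith)
      · intro h hle
        rcases exists_option_between hx hy h with ⟨h1, h2⟩ | ⟨h1, h2⟩
        · obtain ⟨i⟩ := yln.2 h1
          exact ((le_iff _ _).1 hle).1 i ((ihHL i x _ hx hy.sub_one_div_den hG (yl i)).1 h2)
        · obtain ⟨j⟩ := xrn.2 h1
          exact ((le_iff _ _).1 hle).2 j
            ((ihGR j _ _ y (hx.add hx.one_div_den) hy (xr j) hH).1 h2)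

theorem ofRat_le_ofRat {x y : ℚ} (hx : IsDyadic x) (hy : IsDyadic y) :
    Le (ofRat x) (ofRat y) ↔ x ≤ y := by
  refine ⟨fun h => ?_, (le_and_not_le_of_eq_ofRat _ _ x y hx hy rfl rfl).1⟩
  by_contra hn
  exact (le_and_not_le_of_eq_ofRat _ _ y x hy hx rfl rfl).2 (not_le.1 hn) h

theorem HasValue.unique {G : CGame} {x y : ℚ} (hx : HasValue G x) (hy : HasValue G y) : x = y :=
  le_antisymm ((ofRat_le_ofRat hx.1 hy.1).1 (le_trans hx.2.2 hy.2.1))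
    ((ofRat_le_ofRat hy.1 hx.1).1 (le_trans hy.2.2 hx.2.1))

theorem hasValue_ofRat {x : ℚ} (hx : IsDyadic x) : HasValue (ofRat x) x :=
  ⟨hx, le_refl _, le_refl _⟩

/-- The simplicity theorem. -/
theorem hasValue_of_simplest {G : CGame} {x : ℚ} (hx : IsDyadic x)
    (hL : ∀ i, ∃ w, HasValue (G.left i) w ∧ w < x)
    (hR : ∀ j, ∃ w, HasValue (G.right j) w ∧ x < w)
    (hsL : (¬ ∃ n : ℕ, x = -n) → ∃ i w, HasValue (G.left i) w ∧ x - 1 / x.den ≤ w)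
    (hsR : (¬ ∃ n : ℕ, x = n) → ∃ j w, HasValue (G.right j) w ∧ w ≤ x + 1 / x.den) :
    HasValue G x := by
  obtain ⟨xl, xr, xln, xrn⟩ := ofRat_options hx
  refine ⟨hx, (le_iff _ _).2 ⟨fun i h => ?_, fun j h => ?_⟩,
    (le_iff _ _).2 ⟨fun i h => ?_, fun j h => ?_⟩⟩
  · obtain ⟨w, hw, hlt⟩ := hL i
    exact absurd ((ofRat_le_ofRat hx hw.1).1 (le_trans h hw.2.1)) (not_le.2 hlt)
  · obtain ⟨k, w, hw, hle⟩ := hsR (xrn.1 ⟨j⟩)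
    rw [xr] at h
    exact not_right_le G k (le_trans hw.2.1
      (le_trans ((ofRat_le_ofRat hw.1 (hx.add hx.one_div_den)).2 hle) h))
  · obtain ⟨k, w, hw, hle⟩ := hsL (xln.1 ⟨i⟩)
    rw [xl] at h
    exact not_le_left G k (le_trans h
      (le_trans ((ofRat_le_ofRat hx.sub_one_div_den hw.1).2 hle) hw.2.2))
  · obtain ⟨w, hw, hlt⟩ := hR j
    exact absurd ((ofRat_le_ofRat hw.1 hx).1 (le_trans hw.2.2 h)) (not_le.2 hlt)

end CGame
/-! ### Piecewise linear maps with dyadic slopes -/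

/-- On every interval between consecutive integers, `f` has the form `x ↦ (x + c) / 2 ^ s` with
`c` an integer. -/
def IsDyadicPL (f : ℚ → ℚ) : Prop :=
  ∀ n : ℤ, ∃ (s : ℕ) (c : ℤ), ∀ x : ℚ, n ≤ x → x ≤ n + 1 → f x = (x + c) / 2 ^ s

/-- `w` is at least `x - 1 / 2 ^ q` for some denominator `2 ^ q` of `x`. -/
def NearLeft (x w : ℚ) : Prop := ∃ (q : ℕ) (p : ℤ), x * 2 ^ q = p ∧ x - 1 / 2 ^ q ≤ w

/-- `w` is at most `x + 1 / 2 ^ q` for some denominator `2 ^ q` of `x`. -/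
def NearRight (x w : ℚ) : Prop := ∃ (q : ℕ) (p : ℤ), x * 2 ^ q = p ∧ w ≤ x + 1 / 2 ^ q

theorem rel_of_rel_between_integers {R : ℚ → ℚ → Prop} (htrans : ∀ x y z, R x y → R y z → R x z)
    (h : ∀ (n : ℤ) (x y : ℚ), n ≤ x → x < y → y ≤ n + 1 → R x y) {x y : ℚ} (hxy : x < y) :
    R x y := by
  have key : ∀ (k : ℕ) (y : ℚ), x < y → y ≤ ⌊x⌋ + 1 + k → R x y := by
    intro k
    induction k with
    | zero => exact fun y hy hk => h ⌊x⌋ x y (Int.floor_le x) hy (by simpa using hk)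
    | succ k ih =>
      intro y hy hk
      by_cases hk' : y ≤ ⌊x⌋ + 1 + k
      · exact ih y hy hk'
      · have h1 : x < ⌊x⌋ + 1 + k := by
          have := Int.lt_floor_add_one x
          have : (0 : ℚ) ≤ k := by positivity
          linarith
        refine htrans _ _ _ (ih _ h1 le_rfl) (h (⌊x⌋ + 1 + k) _ y ?_ (not_le.1 hk') ?_)
        · push_cast; exact le_rfl
        · push_cast at hk ⊢; linarith
  obtain ⟨k, hk⟩ := exists_nat_ge (y - (⌊x⌋ + 1))
  exact key k y hxy (by linarith)

namespace IsDyadicPL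

variable {f : ℚ → ℚ}

theorem lt_and_sub_le (hf : IsDyadicPL f) {x y : ℚ} (hxy : x < y) :
    f x < f y ∧ f y - f x ≤ y - x := by
  refine rel_of_rel_between_integers (R := fun x y => f x < f y ∧ f y - f x ≤ y - x)
    (fun x y z h1 h2 => ⟨h1.1.trans h2.1, by linarith [h1.2, h2.2]⟩) ?_ hxy
  intro n x y hx hxy hy
  obtain ⟨s, c, h⟩ := hf n
  rw [h x hx (by linarith), h y (by linarith) hy]
  refine ⟨by gcongr, ?_⟩
  rw [← sub_div, add_sub_add_right_eq_sub]
  exact div_le_self (by linarith) (one_le_pow₀ (by norm_num))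

theorem strictMono (hf : IsDyadicPL f) : StrictMono f := fun _ _ h => (hf.lt_and_sub_le h).1

theorem map_add_one_le (hf : IsDyadicPL f) (x : ℚ) : f (x + 1) ≤ f x + 1 := by
  linarith [(hf.lt_and_sub_le (lt_add_one x)).2]

theorem nearLeft (hf : IsDyadicPL f) {x w : ℚ} (h : NearLeft x w) : NearLeft (f x) (f w) := by
  obtain ⟨q, p, hp, hw⟩ := h
  obtain ⟨s, c, hsc⟩ := hf (⌈x⌉ - 1)
  have hq : (0 : ℚ) < 2 ^ q := by positivity
  have h1 : ((⌈x⌉ - 1 : ℤ) : ℚ) < x := by push_cast; linarith [Int.ceil_lt_add_one x]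
  have h2 : x ≤ ((⌈x⌉ - 1 : ℤ) : ℚ) + 1 := by push_cast; linarith [Int.le_ceil x]
  have h3 : ((⌈x⌉ - 1 : ℤ) : ℚ) ≤ x - 1 / 2 ^ q := by
    have h4 : ((⌈x⌉ - 1 : ℤ) : ℚ) * 2 ^ q < p := by rw [← hp]; gcongr
    have h5 : (⌈x⌉ - 1) * 2 ^ q + 1 ≤ p := by exact_mod_cast h4
    have h6 : ((⌈x⌉ - 1 : ℤ) : ℚ) * 2 ^ q + 1 ≤ x * 2 ^ q := by rw [hp]; exact_mod_cast h5
    rw [le_sub_iff_add_le, ← mul_le_mul_iff_left₀ hq, add_mul, one_div, inv_mul_cancel₀ hq.ne']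
    exact h6
  have h7 : 0 < (1 : ℚ) / 2 ^ q := by positivity
  refine ⟨q + s, p + c * 2 ^ q, ?_, ?_⟩
  · rw [hsc x h1.le h2]
    push_cast
    rw [← hp]
    field_simp
    ring
  · refine le_trans (le_of_eq ?_) (hf.strictMono.monotone hw)
    rw [hsc x h1.le h2, hsc _ h3 (by linarith), pow_add]
    field_simp
    ring

theorem nearRight (hf : IsDyadicPL f) {x w : ℚ} (h : NearRight x w) :
    NearRight (f x) (f w) := by
  obtain ⟨q, p, hp, hw⟩ := h
  obtain ⟨s, c, hsc⟩ := hf ⌊x⌋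
  have hq : (0 : ℚ) < 2 ^ q := by positivity
  have h1 : x < (⌊x⌋ : ℚ) + 1 := Int.lt_floor_add_one x
  have h2 : (⌊x⌋ : ℚ) ≤ x := Int.floor_le x
  have h3 : x + 1 / 2 ^ q ≤ (⌊x⌋ : ℚ) + 1 := by
    have h4 : (p : ℚ) < ((⌊x⌋ : ℚ) + 1) * 2 ^ q := by rw [← hp]; gcongr
    have h5 : p + 1 ≤ (⌊x⌋ + 1) * 2 ^ q := by exact_mod_cast h4
    have h6 : x * 2 ^ q + 1 ≤ ((⌊x⌋ : ℚ) + 1) * 2 ^ q := by rw [hp]; exact_mod_cast h5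
    rw [← mul_le_mul_iff_left₀ hq, add_mul, one_div, inv_mul_cancel₀ hq.ne']
    exact h6
  have h7 : 0 < (1 : ℚ) / 2 ^ q := by positivity
  refine ⟨q + s, p + c * 2 ^ q, ?_, ?_⟩
  · rw [hsc x h2 h1.le]
    push_cast
    rw [← hp]
    field_simp
    ring
  · refine le_trans (hf.strictMono.monotone hw) (le_of_eq ?_)
    rw [hsc x h2 h1.le, hsc _ (by linarith) h3, pow_add]
    field_simp
    ring

theorem isDyadic (hf : IsDyadicPL f) {x : ℚ} (hx : CGame.IsDyadic x) : CGame.IsDyadic (f x) := by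
  obtain ⟨q, hq⟩ := hx
  obtain ⟨r, p, hp, -⟩ := hf.nearLeft (w := x) ⟨q, x.num, CGame.mul_two_pow_of_den hq, by simp⟩
  exact CGame.isDyadic_of_mul_eq hp

theorem id : IsDyadicPL fun x => x := fun _ => ⟨0, 0, fun x _ _ => by simp⟩

theorem one_add : IsDyadicPL fun x => 1 + x := fun _ => ⟨0, 1, fun x _ _ => by simp [add_comm]⟩

end IsDyadicPL

theorem NearLeft.mono {x w w' : ℚ} (h : NearLeft x w) (hw : w ≤ w') : NearLeft x w' :=
  let ⟨q, p, hp, hq⟩ := h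
  ⟨q, p, hp, hq.trans hw⟩

theorem NearRight.mono {x w w' : ℚ} (h : NearRight x w) (hw : w' ≤ w) : NearRight x w' :=
  let ⟨q, p, hp, hq⟩ := h
  ⟨q, p, hp, hw.trans hq⟩

theorem nearRight_natCast_add_one (n : ℕ) : NearRight n (n + 1) := ⟨0, n, by simp, by simp⟩

namespace FlippingCoins

/-! ### The effect of a further coin at the left end -/

/-- If `G` has an even number of tails and value `x`, then `0 G` has value `headEven x`. -/
def headEven (x : ℚ) : ℚ :=
  if x < 0 then x
  else if ⌊x⌋ % 3 = 2 then (x - (⌊x⌋ / 3 : ℤ) - 1) / 2 else (x + (⌊x⌋ / 3 : ℤ)) / 4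

/-- If `G` has an odd number of tails and value `x`, then `0 G` has value `headOdd x`. -/
def headOdd (x : ℚ) : ℚ := if x < 1 then x - 1 else headEven (x - 1)

/-- If `G` has an odd number of tails and `1 G` has value `x`, then `1 0 G` has value
`headOneOdd x`. -/
def headOneOdd (x : ℚ) : ℚ := if x < 0 then x else if x < 1 then x / 2 else headEven (x + 1)

theorem headEven_of_neg {x : ℚ} (hx : x < 0) : headEven x = x := if_pos hx

theorem headEven_of_lt {k : ℤ} (hk : 0 ≤ k) {x : ℚ} (h1 : 3 * k ≤ x) (h2 : x < 3 * k + 2) :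
    headEven x = (x + k) / 4 := by
  have hk' : (0 : ℚ) ≤ k := by exact_mod_cast hk
  have h3 : 3 * k ≤ ⌊x⌋ := Int.le_floor.2 (by push_cast; exact h1)
  have h4 : ⌊x⌋ < 3 * k + 2 := Int.floor_lt.2 (by push_cast; exact h2)
  have h5 : ⌊x⌋ / 3 = k := by omega
  rw [headEven, if_neg (by linarith), if_neg (by omega), h5]

theorem headEven_of_mem_high {k : ℤ} (hk : 0 ≤ k) {x : ℚ} (h1 : 3 * k + 2 ≤ x)
    (h2 : x ≤ 3 * k + 3) : headEven x = (x - k - 1) / 2 := by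
  have hk' : (0 : ℚ) ≤ k := by exact_mod_cast hk
  rcases h2.lt_or_eq with h2 | rfl
  · have h3 : 3 * k + 2 ≤ ⌊x⌋ := Int.le_floor.2 (by push_cast; exact h1)
    have h4 : ⌊x⌋ < 3 * k + 3 := Int.floor_lt.2 (by push_cast; exact h2)
    have h5 : ⌊x⌋ / 3 = k := by omega
    rw [headEven, if_neg (by linarith), if_pos (by omega), h5]
  · rw [headEven_of_lt (k := k + 1) (by omega) (by push_cast; linarith) (by push_cast; linarith)]
    push_cast
    ring

theorem headEven_of_mem_low {k : ℤ} (hk : 0 ≤ k) {x : ℚ} (h1 : 3 * k ≤ x) (h2 : x ≤ 3 * k + 2) :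
    headEven x = (x + k) / 4 := by
  rcases h2.lt_or_eq with h2 | rfl
  · exact headEven_of_lt hk h1 h2
  · rw [headEven_of_mem_high hk le_rfl (by linarith)]
    ring

theorem headEven_of_le_two {x : ℚ} (h1 : 0 ≤ x) (h2 : x ≤ 2) : headEven x = x / 4 := by
  simpa using headEven_of_mem_low (k := 0) le_rfl (by simpa using h1) (by simpa using h2)

@[simp] theorem headEven_zero : headEven 0 = 0 := by
  rw [headEven_of_le_two le_rfl (by norm_num), zero_div]

theorem headEven_add_three {x : ℚ} (hx : 0 ≤ x) : headEven (x + 3) = 1 + headEven x := by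
  have hf : (0 : ℤ) ≤ ⌊x⌋ := Int.floor_nonneg.2 hx
  have hf3 : ⌊x + 3⌋ = ⌊x⌋ + 3 := Int.floor_add_natCast x 3
  have h2 : (⌊x⌋ + 3) / 3 = ⌊x⌋ / 3 + 1 := by omega
  have h3 : (⌊x⌋ + 3) % 3 = ⌊x⌋ % 3 := by omega
  rw [headEven, headEven, if_neg (by linarith : ¬ x + 3 < 0), if_neg (by linarith : ¬ x < 0), hf3, h2, h3]
  push_cast
  split_ifs <;> ring

theorem isDyadicPL_headEven : IsDyadicPL headEven := by
  intro n
  rcases lt_or_ge n 0 with hn | hn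
  · refine ⟨0, 0, fun x _ h2 => ?_⟩
    have hn' : (n : ℚ) + 1 ≤ 0 := by exact_mod_cast hn
    rcases (h2.trans hn').lt_or_eq with h | rfl
    · simp [headEven_of_neg h]
    · simp
  · obtain ⟨k, hk⟩ : ∃ k, k = n / 3 := ⟨_, rfl⟩
    have hk0 : 0 ≤ k := by omega
    by_cases h2 : n % 3 = 2
    · refine ⟨1, -k - 1, fun x h3 h4 => ?_⟩
      have hn' : n = 3 * k + 2 := by omega
      rw [hn'] at h3 h4
      push_cast at h3 h4
      rw [headEven_of_mem_high hk0 h3 (by linarith)]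
      push_cast
      ring
    · refine ⟨2, k, fun x h3 h4 => ?_⟩
      have h5 : ((3 * k : ℤ) : ℚ) ≤ n := by exact_mod_cast (by omega : 3 * k ≤ n)
      have h6 : ((n + 1 : ℤ) : ℚ) ≤ ((3 * k + 2 : ℤ) : ℚ) := by
        exact_mod_cast (by omega : n + 1 ≤ 3 * k + 2)
      push_cast at h5 h6
      rw [headEven_of_mem_low hk0 (by linarith) (by linarith)]
      norm_num

theorem headOneOdd_of_one_le {x : ℚ} (h : 1 ≤ x) : headOneOdd x = headEven (x + 1) := by
  rw [headOneOdd, if_neg (by linarith), if_neg (by linarith)]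

theorem headOneOdd_of_le_two {x : ℚ} (h1 : 0 ≤ x) (h2 : x ≤ 2) : headOneOdd x = x / 2 := by
  rcases lt_or_ge x 1 with h | h
  · rw [headOneOdd, if_neg (by linarith), if_pos h]
  · rw [headOneOdd_of_one_le h,
      headEven_of_mem_high (k := 0) le_rfl (by norm_num; linarith) (by norm_num; linarith)]
    push_cast
    ring

theorem headOdd_of_le_one {x : ℚ} (h : x ≤ 1) : headOdd x = x - 1 := by
  rcases h.lt_or_eq with h | rfl
  · rw [headOdd, if_pos h]
  · simp [headOdd]

theorem headOdd_of_one_le {x : ℚ} (h : 1 ≤ x) : headOdd x = headEven (x - 1) := by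
  rw [headOdd, if_neg (by linarith)]

theorem isDyadicPL_headOneOdd : IsDyadicPL headOneOdd := by
  intro n
  rcases lt_trichotomy n 0 with hn | rfl | hn
  · refine ⟨0, 0, fun x _ h2 => ?_⟩
    have hn' : (n : ℚ) + 1 ≤ 0 := by exact_mod_cast hn
    rcases (h2.trans hn').lt_or_eq with h | rfl
    · simp [headOneOdd, h]
    · simp [headOneOdd]
  · refine ⟨1, 0, fun x h1 h2 => ?_⟩
    push_cast at h1 h2
    rw [headOneOdd_of_le_two h1 (by linarith)]
    simp
  · obtain ⟨s, c, h⟩ := isDyadicPL_headEven (n + 1)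
    refine ⟨s, c + 1, fun x h1 h2 => ?_⟩
    have hn' : (1 : ℚ) ≤ n := by exact_mod_cast hn
    rw [headOneOdd_of_one_le (by linarith), h _ (by push_cast; linarith) (by push_cast; linarith)]
    push_cast
    ring

theorem isDyadicPL_headOdd : IsDyadicPL headOdd := by
  intro n
  rcases le_or_gt n 0 with hn | hn
  · refine ⟨0, -1, fun x _ h2 => ?_⟩
    have hn' : (n : ℚ) ≤ 0 := by exact_mod_cast hn
    rw [headOdd_of_le_one (by linarith)]
    simp [sub_eq_add_neg]
  · obtain ⟨s, c, h⟩ := isDyadicPL_headEven (n - 1)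
    refine ⟨s, c - 1, fun x h1 h2 => ?_⟩
    have hn' : (1 : ℚ) ≤ n := by exact_mod_cast hn
    rw [headOdd_of_one_le (by linarith), h _ (by push_cast; linarith) (by push_cast; linarith)]
    push_cast
    ring

theorem headEven_nonneg {x : ℚ} (h : 0 ≤ x) : 0 ≤ headEven x := by
  simpa using isDyadicPL_headEven.strictMono.monotone h

theorem headEven_le_self {x : ℚ} (h : 0 ≤ x) : headEven x ≤ x := by
  rcases h.lt_or_eq with h | rfl
  · have := (isDyadicPL_headEven.lt_and_sub_le h).2
    simpa using this
  · simp

theorem headOneOdd_pos {x : ℚ} (h : 0 < x) : 0 < headOneOdd x := by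
  have := isDyadicPL_headOneOdd.strictMono h
  rwa [headOneOdd_of_le_two le_rfl (by norm_num), zero_div] at this

theorem headOneOdd_le_self {x : ℚ} (h : 0 < x) : headOneOdd x ≤ x := by
  have := (isDyadicPL_headOneOdd.lt_and_sub_le h).2
  rw [headOneOdd_of_le_two le_rfl (by norm_num)] at this
  linarith

theorem headOdd_lt_self (x : ℚ) : headOdd x < x := by
  rcases le_or_gt x 1 with h | h
  · rw [headOdd_of_le_one h]; linarith
  · rw [headOdd_of_one_le h.le]
    linarith [headEven_le_self (x := x - 1) (by linarith)]

theorem headOdd_lt_headEven {x : ℚ} (h : 0 ≤ x) : headOdd x < headEven x := by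
  rcases lt_or_ge x 1 with h1 | h1
  · rw [headOdd_of_le_one h1.le]; linarith [headEven_nonneg h]
  · rw [headOdd_of_one_le h1]
    exact isDyadicPL_headEven.strictMono (by linarith)

theorem headEven_lt_headOneOdd {x : ℚ} (h : 0 < x) : headEven x < headOneOdd x := by
  rcases lt_or_ge x 1 with h1 | h1
  · rw [headOneOdd_of_le_two h.le (by linarith), headEven_of_le_two h.le (by linarith)]
    linarith
  · rw [headOneOdd_of_one_le h1]
    exact isDyadicPL_headEven.strictMono (by linarith)

theorem headOdd_lt_headOneOdd {x : ℚ} (h : 0 < x) : headOdd x < headOneOdd x :=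
  (headOdd_lt_headEven h.le).trans (headEven_lt_headOneOdd h)

theorem headOneOdd_one_add_lt {x : ℚ} (h : 0 ≤ x) : headOneOdd (1 + x) < 1 + headEven x := by
  rw [headOneOdd_of_one_le (by linarith), ← headEven_add_three h]
  exact isDyadicPL_headEven.strictMono (by linarith)

/-! ### The value of a line -/

/-- What the coins to the left need to know about a line: its value if the number of tails
is even; its value and the value after adding a tail at the left end if that number is odd. -/
inductive State : Type
  | even (x : ℚ) : State
  | odd (y z : ℚ) : State

namespace State

/-- The value of the line. -/
def val : State → ℚ
  | even x => x
  | odd y _ => y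

/-- The state after adding a coin at the left end. -/
def cons : Bool → State → State
  | false, even x => even (headEven x)
  | true, even x => odd x (1 + x)
  | false, odd y z => odd (headOdd y) (headOneOdd z)
  | true, odd _ z => even z

/-- The state after adding a line at the left end. -/
def append (G : Line) (s : State) : State := G.foldr cons s

/-- The inequalities that hold for states of lines. -/
def Valid : State → Prop
  | even x => 0 ≤ x ∧ CGame.IsDyadic x
  | odd y z => y < z ∧ 0 < z ∧ CGame.IsDyadic y ∧ CGame.IsDyadic z

/-- Strict inequality between states of the same parity. -/
def Lt : State → State → Prop
  | even x, even x' => x < x'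
  | odd y z, odd y' z' => y < y' ∧ z < z'
  | _, _ => False

theorem Lt.trans {s t u : State} (h₁ : Lt s t) (h₂ : Lt t u) : Lt s u := by
  cases s <;> cases t <;> cases u <;> simp only [Lt] at * <;>
    first | exact h₁.trans h₂ | exact ⟨h₁.1.trans h₂.1, h₁.2.trans h₂.2⟩

theorem Lt.val_lt {s t : State} (h : Lt s t) : s.val < t.val := by
  cases s <;> cases t <;> simp only [Lt] at h
  · exact h
  · exact h.1

theorem Lt.cons {s t : State} (h : Lt s t) (d : Bool) : Lt (s.cons d) (t.cons d) := by
  cases s <;> cases t <;> simp only [Lt] at h <;> cases d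
  · exact isDyadicPL_headEven.strictMono h
  · exact ⟨h, by simpa using h⟩
  · exact ⟨isDyadicPL_headOdd.strictMono h.1, isDyadicPL_headOneOdd.strictMono h.2⟩
  · exact h.2

theorem Lt.append {s t : State} (h : Lt s t) (G : Line) : Lt (append G s) (append G t) := by
  induction G with
  | nil => exact h
  | cons d G ih => exact ih.cons d

theorem Valid.isDyadic_val {s : State} (h : s.Valid) : CGame.IsDyadic s.val := by
  cases s
  · exact h.2
  · exact h.2.2.1

theorem Valid.cons {s : State} (h : s.Valid) (d : Bool) : (s.cons d).Valid := by
  cases s <;> cases d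
  · exact ⟨headEven_nonneg h.1, isDyadicPL_headEven.isDyadic h.2⟩
  · exact ⟨by linarith, by linarith [h.1], h.2, IsDyadicPL.one_add.isDyadic h.2⟩
  · exact ⟨(isDyadicPL_headOdd.strictMono h.1).trans (headOdd_lt_headOneOdd h.2.1),
      headOneOdd_pos h.2.1, isDyadicPL_headOdd.isDyadic h.2.2.1,
      isDyadicPL_headOneOdd.isDyadic h.2.2.2⟩
  · exact ⟨h.2.1.le, h.2.2.2⟩

theorem Valid.append {s : State} (h : s.Valid) (G : Line) : (append G s).Valid := by
  induction G with
  | nil => exact h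
  | cons d G ih => exact ih.cons d

theorem Valid.swap_lt {s : State} (h : s.Valid) :
    Lt ((s.cons true).cons false) ((s.cons false).cons true) := by
  cases s
  · exact ⟨headOdd_lt_headEven h.1, headOneOdd_one_add_lt h.1⟩
  · exact headEven_lt_headOneOdd h.2.1

theorem Valid.erase_lt {s : State} (h : s.Valid) :
    Lt ((s.cons false).cons false) ((s.cons true).cons true) := by
  cases s with
  | even x =>
    have h1 := headEven_le_self h.1
    have h2 := headEven_le_self (headEven_nonneg h.1)
    exact (by linarith : headEven (headEven x) < 1 + x)
  | odd y z =>
    have h1 := headOdd_lt_self y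
    have h2 := headOdd_lt_self (headOdd y)
    have h3 := headOneOdd_le_self h.2.1
    have h4 := headOneOdd_le_self (headOneOdd_pos h.2.1)
    exact ⟨by linarith [h.1], by linarith⟩

theorem Valid.append_right_lt {s : State} (h : s.Valid) (G : Line) :
    Lt (State.append (false :: (G ++ [true])) s) (State.append (true :: (G ++ [false])) s) := by
  induction G with
  | nil => exact h.swap_lt
  | cons d G ih =>
    cases d
    · exact (ih.cons false).trans (h.append (G ++ [false])).swap_lt
    · exact (h.append (G ++ [true])).swap_lt.trans (ih.cons true)

theorem Valid.append_left_lt {s : State} (h : s.Valid) (G : Line) :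
    Lt (State.append (false :: (G ++ [false])) s) (State.append (true :: (G ++ [true])) s) := by
  induction G with
  | nil => exact h.erase_lt
  | cons d G ih =>
    cases d
    · exact (ih.cons false).trans (h.append (G ++ [true])).swap_lt
    · exact (h.append (G ++ [false])).swap_lt.trans (ih.cons true)

end State

/-- The state of a line. -/
def state (G : Line) : State := State.append G (State.even 0)

/-- The value of a line. -/
def value (G : Line) : ℚ := (state G).val

theorem state_cons (d : Bool) (G : Line) : state (d :: G) = (state G).cons d := rfl

theorem state_append (G H : Line) : state (G ++ H) = State.append G (state H) := by
  simp [state, State.append, List.foldr_append]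

theorem State.append_append (G H : Line) (s : State) :
    State.append (G ++ H) s = State.append G (State.append H s) := by
  simp [State.append, List.foldr_append]

theorem valid_state (G : Line) : (state G).Valid :=
  State.Valid.append (s := .even 0) ⟨le_rfl, CGame.isDyadic_intCast 0⟩ G

theorem state_trim (G : Line) : state (trim G) = state G := by
  induction G using List.reverseRecOn with
  | nil => rfl
  | append_singleton G d ih =>
    cases d
    · rw [trim, List.rdropWhile_concat_pos _ _ _ (by simp), ← trim, ih, state_append]
      simp [state, State.append, State.cons]
    · rw [trim, List.rdropWhile_concat_neg _ _ _ (by simp)]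

theorem value_trim (G : Line) : value (trim G) = value G := by rw [value, state_trim, value]

/-! ### Moves -/

/-- A move of Left, before trimming. -/
def LeftStep (G H : Line) : Prop :=
  ∃ α ω β : Line, G = α ++ true :: (ω ++ true :: β) ∧ H = α ++ false :: (ω ++ false :: β)

/-- A move of Right, before trimming. -/
def RightStep (G H : Line) : Prop :=
  ∃ α ω β : Line, G = α ++ false :: (ω ++ true :: β) ∧ H = α ++ true :: (ω ++ false :: β)

theorem LeftStep.cons {G H : Line} (h : LeftStep G H) (d : Bool) : LeftStep (d :: G) (d :: H) :=
  let ⟨α, ω, β, h₁, h₂⟩ := h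
  ⟨d :: α, ω, β, by rw [h₁]; rfl, by rw [h₂]; rfl⟩

theorem RightStep.cons {G H : Line} (h : RightStep G H) (d : Bool) :
    RightStep (d :: G) (d :: H) :=
  let ⟨α, ω, β, h₁, h₂⟩ := h
  ⟨d :: α, ω, β, by rw [h₁]; rfl, by rw [h₂]; rfl⟩

theorem LeftStep.state_lt {G H : Line} (h : LeftStep G H) : (state H).Lt (state G) := by
  obtain ⟨α, ω, β, rfl, rfl⟩ := h
  rw [state_append, state_append]
  refine State.Lt.append ?_ α
  have := (valid_state β).append_left_lt ω
  simpa [State.append, state] using this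

theorem RightStep.state_lt {G H : Line} (h : RightStep G H) : (state G).Lt (state H) := by
  obtain ⟨α, ω, β, rfl, rfl⟩ := h
  rw [state_append, state_append]
  refine State.Lt.append ?_ α
  have := (valid_state β).append_right_lt ω
  simpa [State.append, state] using this

theorem exists_append_of_getElem? {G : Line} {i : ℕ} {b : Bool} (h : G[i]? = some b) :
    ∃ α β : Line, G = α ++ b :: β ∧ α.length = i := by
  obtain ⟨hi, rfl⟩ := List.getElem?_eq_some_iff.1 h
  exact ⟨G.take i, G.drop (i + 1), by simp, by simp; omega⟩

theorem exists_append_of_pair {G : Line} {i j : ℕ} {b c : Bool} (hij : i < j)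
    (hi : G[i]? = some b) (hj : G[j]? = some c) :
    ∃ α ω β : Line, G = α ++ b :: (ω ++ c :: β) ∧
      ∀ b' c', (G.set i b').set j c' = α ++ b' :: (ω ++ c' :: β) := by
  obtain ⟨α, γ, rfl, rfl⟩ := exists_append_of_getElem? hi
  obtain ⟨k, rfl⟩ := Nat.exists_eq_add_of_lt hij
  have hj' : γ[k]? = some c := by
    rw [List.getElem?_append_right (by omega)] at hj
    simpa [show α.length + k + 1 - α.length = k + 1 by omega] using hj
  obtain ⟨ω, β, rfl, rfl⟩ := exists_append_of_getElem? hj'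
  refine ⟨α, ω, β, rfl, fun b' c' => ?_⟩
  rw [List.set_append_right _ _ le_rfl, Nat.sub_self, List.set_cons_zero,
    List.set_append_right _ _ (by omega),
    show α.length + ω.length + 1 - α.length = ω.length + 1 by omega, List.set_cons_succ,
    List.set_append_right _ _ le_rfl, Nat.sub_self, List.set_cons_zero]

theorem exists_leftStep (G : Line) (m : LeftMove G) :
    ∃ H, LeftStep G H ∧ playLeft G m = trim H := by
  obtain ⟨⟨i, j⟩, hij, hi, hj⟩ := m
  obtain ⟨α, ω, β, h1, h2⟩ := exists_append_of_pair hij hi hj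
  exact ⟨_, ⟨α, ω, β, h1, rfl⟩, congrArg trim (h2 _ _)⟩

theorem exists_rightStep (G : Line) (m : RightMove G) :
    ∃ H, RightStep G H ∧ playRight G m = trim H := by
  obtain ⟨⟨i, j⟩, hij, hi, hj⟩ := m
  obtain ⟨α, ω, β, h1, h2⟩ := exists_append_of_pair hij hi hj
  exact ⟨_, ⟨α, ω, β, h1, rfl⟩, congrArg trim (h2 _ _)⟩

theorem LeftStep.exists_move {G H : Line} (h : LeftStep G H) :
    ∃ m : LeftMove G, playLeft G m = trim H := by
  obtain ⟨α, ω, β, rfl, rfl⟩ := h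
  have e : α.length + (ω.length + 1) - α.length = ω.length + 1 := by omega
  refine ⟨⟨(α.length, α.length + (ω.length + 1)), by simp, by simp, ?_⟩, ?_⟩
  · dsimp only
    rw [List.getElem?_append_right (by omega), e]
    simp
  · dsimp only [playLeft]
    rw [List.set_append_right _ _ le_rfl, Nat.sub_self, List.set_cons_zero,
      List.set_append_right _ _ (by omega), e, List.set_cons_succ,
      List.set_append_right _ _ le_rfl, Nat.sub_self, List.set_cons_zero]

theorem RightStep.exists_move {G H : Line} (h : RightStep G H) :
    ∃ m : RightMove G, playRight G m = trim H := by
  obtain ⟨α, ω, β, rfl, rfl⟩ := h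
  have e : α.length + (ω.length + 1) - α.length = ω.length + 1 := by omega
  refine ⟨⟨(α.length, α.length + (ω.length + 1)), by simp, by simp, ?_⟩, ?_⟩
  · dsimp only
    rw [List.getElem?_append_right (by omega), e]
    simp
  · dsimp only [playRight]
    rw [List.set_append_right _ _ le_rfl, Nat.sub_self, List.set_cons_zero,
      List.set_append_right _ _ (by omega), e, List.set_cons_succ,
      List.set_append_right _ _ le_rfl, Nat.sub_self, List.set_cons_zero]

end FlippingCoins
namespace FlippingCoins

namespace State

/-- The value after adding a tail at the left end. -/
def valCons : State → ℚ
  | even x => x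
  | odd _ z => z

/-- Whether the number of tails is even. -/
def isEven : State → Bool
  | even _ => true
  | odd _ _ => false

theorem Lt.isEven_eq {s t : State} (h : Lt s t) : s.isEven = t.isEven := by
  cases s <;> cases t <;> simp only [Lt] at h <;> rfl

end State

theorem state_eq_of_not_mem {G : Line} (h : true ∉ G) : state G = State.even 0 := by
  induction G with
  | nil => rfl
  | cons d G ih =>
    rw [List.mem_cons, not_or] at h
    cases d
    · rw [state_cons, ih h.2, State.cons, headEven_zero]
    · exact absurd rfl h.1

/-- Left has a move whose effect on `φ` is as small as required by the simplicity theorem. -/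
def HasNearLeft (φ : State → ℚ) (G : Line) : Prop :=
  ∃ H, LeftStep G H ∧ NearLeft (φ (state G)) (φ (state H))

/-- Right has a move whose effect on `φ` is as small as required by the simplicity theorem. -/
def HasNearRight (φ : State → ℚ) (G : Line) : Prop :=
  ∃ H, RightStep G H ∧ NearRight (φ (state G)) (φ (state H))

section

variable {φ ψ : State → ℚ} {f : ℚ → ℚ} {G : Line} {d : Bool}

theorem HasNearLeft.cons (hf : IsDyadicPL f)
    (h : ∀ s : State, s.isEven = (state G).isEven → φ (s.cons d) = f (ψ s))
    (hG : HasNearLeft ψ G) : HasNearLeft φ (d :: G) := by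
  obtain ⟨H, hs, hn⟩ := hG
  refine ⟨d :: H, hs.cons d, ?_⟩
  rw [state_cons, state_cons, h _ rfl, h _ hs.state_lt.isEven_eq]
  exact hf.nearLeft hn

theorem HasNearRight.cons (hf : IsDyadicPL f)
    (h : ∀ s : State, s.isEven = (state G).isEven → φ (s.cons d) = f (ψ s))
    (hG : HasNearRight ψ G) : HasNearRight φ (d :: G) := by
  obtain ⟨H, hs, hn⟩ := hG
  refine ⟨d :: H, hs.cons d, ?_⟩
  rw [state_cons, state_cons, h _ rfl, h _ hs.state_lt.isEven_eq.symm]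
  exact hf.nearRight hn

end

/-- The upper bounds met by Right's move of the first tail of `G` to the head before it,
in `0 G`. -/
def FirstTailBound : State → State → Prop
  | .even x, .even x' => 1 ≤ x → x' ≤ headEven (x + 1)
  | .odd y z, .odd y' z' =>
      (0 ≤ y → y' ≤ headOdd (y + 1)) ∧ (1 ≤ z → z' ≤ headOneOdd (z + 1))
  | _, _ => False

theorem FirstTailBound.cons_false {s s' : State} (hs : s.Valid) (h : FirstTailBound s s') :
    FirstTailBound (s.cons false) (s'.cons false) := by
  cases s <;> cases s' <;> simp only [FirstTailBound] at h
  · intro h1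
    exact isDyadicPL_headEven.strictMono.monotone
      ((h (h1.trans (headEven_le_self hs.1))).trans (isDyadicPL_headEven.map_add_one_le _))
  · refine ⟨fun h1 => ?_, fun h1 => ?_⟩
    · exact isDyadicPL_headOdd.strictMono.monotone
        ((h.1 (h1.trans (headOdd_lt_self _).le)).trans (isDyadicPL_headOdd.map_add_one_le _))
    · exact isDyadicPL_headOneOdd.strictMono.monotone
        ((h.2 (h1.trans (headOneOdd_le_self hs.2.1))).trans
          (isDyadicPL_headOneOdd.map_add_one_le _))

theorem exists_rightStep_firstTailBound {G : Line} (hG : true ∈ G) :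
    ∃ H, RightStep (false :: G) H ∧ FirstTailBound (state G) (state H) := by
  induction G with
  | nil => simp at hG
  | cons d G ih =>
    cases d
    · obtain ⟨H, h1, h2⟩ := ih (by simpa using hG)
      exact ⟨false :: H, h1.cons false, h2.cons_false (valid_state G)⟩
    · refine ⟨true :: false :: G, ⟨[], [], G, rfl, rfl⟩, ?_⟩
      rw [state_cons, state_cons, state_cons]
      have hv := valid_state G
      cases hs : state G with
      | even x =>
        rw [hs] at hv
        refine ⟨fun _ => ?_, fun _ => ?_⟩
        · rw [headOdd_of_one_le (by linarith [hv.1]), add_sub_cancel_right]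
        · rw [headOneOdd_of_one_le (by linarith [hv.1]), ← headEven_add_three hv.1]
          exact (congrArg headEven (by ring)).le
      | odd y z => exact fun h1 => (headOneOdd_of_one_le h1).le

theorem near_options_cons_false {G : Line}
    (hL : (¬ ∃ n : ℕ, (state G).val = -n) → HasNearLeft State.val G)
    (hR : (¬ ∃ n : ℕ, (state G).val = n) → HasNearRight State.val G) :
    ((¬ ∃ n : ℕ, (state (false :: G)).val = -n) → HasNearLeft State.val (false :: G)) ∧
    ((¬ ∃ n : ℕ, (state (false :: G)).val = n) → HasNearRight State.val (false :: G)) := by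
  have hv := valid_state G
  cases hs : state G with
  | even x =>
    simp only [state_cons, hs, State.val, State.cons] at hL hR ⊢
    rw [hs] at hv
    have hf : ∀ s : State, s.isEven = (state G).isEven →
        (s.cons false).val = headEven s.val := by
      intro s h
      cases s
      · rfl
      · rw [hs] at h; cases h
    refine ⟨fun h => (hL ?_).cons isDyadicPL_headEven hf, fun h => ?_⟩
    · rintro ⟨n, hn⟩
      have h0 : x = 0 := le_antisymm (by rw [hn]; simp) hv.1
      exact h ⟨0, by simp [h0]⟩
    · by_cases hx : ∃ n : ℕ, x = n
      · obtain ⟨n, rfl⟩ := hx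
        have hn : n ≠ 0 := by
          rintro rfl
          exact h ⟨0, by simp⟩
        have hmem : true ∈ G := by
          by_contra hc
          rw [state_eq_of_not_mem hc, State.even.injEq] at hs
          exact hn (by exact_mod_cast hs.symm)
        obtain ⟨H, h1, h2⟩ := exists_rightStep_firstTailBound hmem
        refine ⟨H, h1, ?_⟩
        rw [state_cons]
        rw [hs] at h2 ⊢
        cases hH : state H with
        | even x' =>
          rw [hH] at h2
          exact (isDyadicPL_headEven.nearRight (nearRight_natCast_add_one n)).mono
            (h2 (by exact_mod_cast Nat.one_le_iff_ne_zero.2 hn))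
        | odd => rw [hH] at h2; exact h2.elim
      · exact (hR hx).cons isDyadicPL_headEven hf
  | odd y z =>
    simp only [state_cons, hs, State.val, State.cons] at hL hR ⊢
    have hf : ∀ s : State, s.isEven = (state G).isEven →
        (s.cons false).val = headOdd s.val := by
      intro s h
      cases s
      · rw [hs] at h; cases h
      · rfl
    refine ⟨fun h => (hL ?_).cons isDyadicPL_headOdd hf, fun h => ?_⟩
    · rintro ⟨n, rfl⟩
      have hn : (0 : ℚ) ≤ n := by positivity
      exact h ⟨n + 1, by rw [headOdd_of_le_one (by linarith)]; push_cast; ring⟩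
    · by_cases hx : ∃ n : ℕ, y = n
      · obtain ⟨n, rfl⟩ := hx
        have hmem : true ∈ G := by
          by_contra hc
          rw [state_eq_of_not_mem hc] at hs
          cases hs
        obtain ⟨H, h1, h2⟩ := exists_rightStep_firstTailBound hmem
        refine ⟨H, h1, ?_⟩
        rw [state_cons]
        rw [hs] at h2 ⊢
        cases hH : state H with
        | even => rw [hH] at h2; exact h2.elim
        | odd y' z' =>
          rw [hH] at h2
          exact (isDyadicPL_headOdd.nearRight (nearRight_natCast_add_one n)).mono
            (h2.1 (by positivity))
      · exact (hR hx).cons isDyadicPL_headOdd hf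

theorem near_options_valCons_cons_false {G : Line} (hodd : (state G).isEven = false)
    (hL : (¬ ∃ m : ℕ, (state G).valCons = 1 / 2 ^ m) → HasNearLeft State.valCons G)
    (hR : (¬ ∃ n : ℕ, (state G).valCons = n) → HasNearRight State.valCons G) :
    ((¬ ∃ m : ℕ, (state (false :: G)).valCons = 1 / 2 ^ m) →
      HasNearLeft State.valCons (false :: G)) ∧
    ((¬ ∃ n : ℕ, (state (false :: G)).valCons = n) →
      HasNearRight State.valCons (false :: G)) := by
  have hv := valid_state G
  cases hs : state G with
  | even x => rw [hs] at hodd; cases hodd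
  | odd y z =>
    rw [hs] at hv
    simp only [state_cons, hs, State.valCons, State.cons] at hL hR ⊢
    have hf : ∀ s : State, s.isEven = (state G).isEven →
        (s.cons false).valCons = headOneOdd s.valCons := by
      intro s h
      cases s
      · rw [hs] at h; cases h
      · rfl
    refine ⟨fun h => (hL ?_).cons isDyadicPL_headOneOdd hf, fun h => ?_⟩
    · rintro ⟨m, rfl⟩
      have h1 : (1 : ℚ) / 2 ^ m ≤ 1 := div_le_self zero_le_one (one_le_pow₀ (by norm_num))
      refine h ⟨m + 1, ?_⟩
      rw [headOneOdd_of_le_two (by positivity) (by linarith), pow_succ, div_div]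
    · by_cases hx : ∃ n : ℕ, z = n
      · obtain ⟨n, rfl⟩ := hx
        have hn : 1 ≤ n := Nat.pos_of_ne_zero fun h0 => by
          have := hv.2.1
          simp [h0] at this
        have hmem : true ∈ G := by
          by_contra hc
          rw [state_eq_of_not_mem hc] at hs
          cases hs
        obtain ⟨H, h1, h2⟩ := exists_rightStep_firstTailBound hmem
        refine ⟨H, h1, ?_⟩
        rw [state_cons]
        rw [hs] at h2 ⊢
        cases hH : state H with
        | even => rw [hH] at h2; exact h2.elim
        | odd y' z' =>
          rw [hH] at h2
          exact (isDyadicPL_headOneOdd.nearRight (nearRight_natCast_add_one n)).mono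
            (h2.2 (by exact_mod_cast hn))
      · exact (hR hx).cons isDyadicPL_headOneOdd hf

theorem near_options (G : Line) :
    ((¬ ∃ n : ℕ, (state G).val = -n) → HasNearLeft State.val G) ∧
    ((¬ ∃ n : ℕ, (state G).val = n) → HasNearRight State.val G) ∧
    ((state G).isEven = false →
      ((¬ ∃ m : ℕ, (state G).valCons = 1 / 2 ^ m) → HasNearLeft State.valCons G) ∧
      ((¬ ∃ n : ℕ, (state G).valCons = n) → HasNearRight State.valCons G)) := by
  induction G with
  | nil => exact ⟨fun h => absurd ⟨0, by simp [state, State.append, State.val]⟩ h,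
      fun h => absurd ⟨0, by simp [state, State.append, State.val]⟩ h, fun h => by cases h⟩
  | cons d G ih =>
    obtain ⟨ihL, ihR, ihO⟩ := ih
    cases d
    · refine ⟨(near_options_cons_false ihL ihR).1, (near_options_cons_false ihL ihR).2,
        fun h => ?_⟩
      have hodd : (state G).isEven = false := by
        rw [state_cons] at h
        cases hs : state G <;> rw [hs] at h
        · cases h
        · rfl
      exact near_options_valCons_cons_false hodd (ihO hodd).1 (ihO hodd).2
    · have hv := valid_state G
      cases hs : state G with
      | even x =>
        simp only [state_cons, hs, State.val, State.valCons, State.cons] at ihL ihR ⊢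
        rw [hs] at hv
        have hf : ∀ s : State, s.isEven = (state G).isEven → (s.cons true).val = s.val := by
          intro s h
          cases s
          · rfl
          · rw [hs] at h; cases h
        have hf' : ∀ s : State, s.isEven = (state G).isEven →
            (s.cons true).valCons = 1 + s.val := by
          intro s h
          cases s
          · rfl
          · rw [hs] at h; cases h
        refine ⟨fun h => (ihL h).cons .id hf, fun h => (ihR h).cons .id hf, fun _ =>
          ⟨fun h => (ihL ?_).cons .one_add hf', fun h => (ihR ?_).cons .one_add hf'⟩⟩
        · rintro ⟨n, hn⟩
          have h0 : x = 0 := le_antisymm (by rw [hn]; simp) hv.1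
          exact h ⟨0, by simp [h0]⟩
        · rintro ⟨n, rfl⟩
          exact h ⟨1 + n, by push_cast; ring⟩
      | odd y z =>
        rw [hs] at ihO
        obtain ⟨ihO1, ihO2⟩ := ihO rfl
        have hf : ∀ s : State, s.isEven = (state G).isEven →
            (s.cons true).val = s.valCons := by
          intro s h
          cases s
          · rw [hs] at h; cases h
          · rfl
        simp only [state_cons, hs, State.val, State.valCons, State.cons] at ihO1 ihO2 ⊢
        refine ⟨fun h => ?_, fun h => (ihO2 h).cons .id hf, fun h => by cases h⟩
        by_cases hz : ∃ m : ℕ, z = 1 / 2 ^ m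
        · obtain ⟨m, hm⟩ := hz
          have hmem : true ∈ G := by
            by_contra hc
            rw [state_eq_of_not_mem hc] at hs
            cases hs
          obtain ⟨α, β, rfl⟩ := List.append_of_mem hmem
          have hstep : LeftStep (true :: (α ++ true :: β)) (false :: (α ++ false :: β)) :=
            ⟨[], α, β, rfl, rfl⟩
          refine ⟨_, hstep, m, 1, ?_, ?_⟩
          · rw [state_cons, hs]
            simp only [State.cons, State.val]
            rw [hm]
            field_simp
            simp
          · have hpar := hstep.state_lt.isEven_eq
            rw [state_cons true, hs] at hpar ⊢
            have hv' := valid_state (false :: (α ++ false :: β))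
            cases hs' : state (false :: (α ++ false :: β)) with
            | even x' =>
              rw [hs'] at hv'
              simp only [State.cons, State.val]
              rw [hm, sub_self]
              exact hv'.1
            | odd => rw [hs'] at hpar; cases hpar
        · exact (ihO1 hz).cons .id hf

/-- Every line has its value. -/
theorem hasValue_game (G : Line) : CGame.HasValue (game G) (value G) := by
  induction hn : binary G using Nat.strong_induction_on generalizing G with
  | _ n ih =>
    subst hn
    have hL : ∀ m : LeftMove G,
        CGame.HasValue (game (playLeft G m)) (value (playLeft G m)) :=
      fun m => ih _ (binary_playLeft_lt G m) _ rfl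
    have hR : ∀ m : RightMove G,
        CGame.HasValue (game (playRight G m)) (value (playRight G m)) :=
      fun m => ih _ (binary_playRight_lt G m) _ rfl
    obtain ⟨h1, h2, -⟩ := near_options G
    rw [game]
    refine CGame.hasValue_of_simplest (valid_state G).isDyadic_val
      (fun m => ⟨_, hL m, ?_⟩) (fun m => ⟨_, hR m, ?_⟩) (fun h => ?_) (fun h => ?_)
    · obtain ⟨H, hs, he⟩ := exists_leftStep G m
      rw [he, value_trim]
      exact hs.state_lt.val_lt
    · obtain ⟨H, hs, he⟩ := exists_rightStep G m
      rw [he, value_trim]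
      exact hs.state_lt.val_lt
    · obtain ⟨H, hs, q, p, hp, hle⟩ := h1 h
      obtain ⟨m, hm⟩ := hs.exists_move
      refine ⟨m, _, hL m, ?_⟩
      rw [hm, value_trim]
      refine le_trans ?_ hle
      rw [value]
      linarith [CGame.one_div_two_pow_le_of_mul_eq hp]
    · obtain ⟨H, hs, q, p, hp, hle⟩ := h2 h
      obtain ⟨m, hm⟩ := hs.exists_move
      refine ⟨m, _, hR m, ?_⟩
      rw [hm, value_trim]
      refine hle.trans ?_
      rw [value]
      linarith [CGame.one_div_two_pow_le_of_mul_eq hp]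

end FlippingCoins
namespace CGame

/-! ### Ordinal sums of numbers -/

theorem den_add_one_div_two_pow {x : ℚ} {s : ℕ} (hx : x.den = 2 ^ s) {m : ℕ} (hm : m ≠ 0) :
    (x + 1 / 2 ^ (s + m)).den = 2 ^ (s + m) := by
  obtain ⟨k, rfl⟩ := Nat.exists_eq_succ_of_ne_zero hm
  have hodd : ¬ Even (x.num * 2 ^ (k + 1) + 1) := by
    rw [pow_succ]
    intro h
    obtain ⟨r, hr⟩ := h
    have : x.num * (2 ^ k * 2) = 2 * (x.num * 2 ^ k) := by ring
    omega
  have hx' : x + 1 / 2 ^ (s + (k + 1)) =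
      ((x.num * 2 ^ (k + 1) + 1 : ℤ) : ℚ) / 2 ^ (s + (k + 1)) := by
    push_cast
    rw [← mul_two_pow_of_den hx, pow_add]
    field_simp
  exact (congrArg Rat.den hx').trans (num_den_of_odd hodd _).2

theorem hasValue_ordinalSum_zero {v : ℚ} (hv : IsDyadic v) :
    HasValue (ordinalSum (ofRat v) (ofRat 0)) v := by
  obtain ⟨vl, vr, vln, vrn⟩ := ofRat_options hv
  have h0 : ofRat 0 = mk Empty Empty Empty.elim Empty.elim := ofRat_intCast 0
  have hpos := one_div_den_pos v
  rw [h0]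
  refine hasValue_of_simplest hv ?_ ?_ (fun h => ?_) (fun h => ?_)
  · rintro (i | i)
    · refine ⟨v - 1 / v.den, ?_, by linarith⟩
      exact vl i ▸ hasValue_ofRat hv.sub_one_div_den
    · exact i.elim
  · rintro (i | i)
    · refine ⟨v + 1 / v.den, ?_, by linarith⟩
      exact vr i ▸ hasValue_ofRat (hv.add hv.one_div_den)
    · exact i.elim
  · obtain ⟨i⟩ := vln.2 h
    exact ⟨.inl i, _, vl i ▸ hasValue_ofRat hv.sub_one_div_den, le_rfl⟩
  · obtain ⟨i⟩ := vrn.2 h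
    exact ⟨.inl i, _, vr i ▸ hasValue_ofRat (hv.add hv.one_div_den), le_rfl⟩

theorem isOrdinalSum_one_div_two_pow {v : ℚ} {s : ℕ} (hs : v.den = 2 ^ s)
    (hn : ¬ ∃ n : ℕ, v = n) (k : ℕ) :
    IsOrdinalSum (v + 1 / 2 ^ (s + (k + 1))) v (1 / 2 ^ k) := by
  have hv : IsDyadic v := ⟨s, hs⟩
  obtain ⟨vl, vr, vln, vrn⟩ := ofRat_options hv
  have hpos := one_div_den_pos v
  have hden : ∀ k : ℕ, ((1 : ℚ) / 2 ^ k).den = 2 ^ k := fun k => by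
    simp
  have hhalf : ∀ k : ℕ, (1 : ℚ) / 2 ^ (k + 1) = 1 / 2 ^ k / 2 := fun k => by
    rw [pow_succ, div_div]
  have hle : ∀ k : ℕ, (1 : ℚ) / 2 ^ (s + k) ≤ 1 / 2 ^ s := fun k =>
    one_div_le_one_div_of_le (by positivity) (pow_le_pow_right₀ (by norm_num) (by omega))
  induction k with
  | zero =>
    have h1 : ofRat (1 / 2 ^ 0) = mk Unit Empty (fun _ => ofRat 0) Empty.elim := by
      have h1 : ofRat 1 = ofNat 1 := ofRat_intCast 1
      have h0 : ofRat 0 = ofNat 0 := ofRat_intCast 0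
      rw [pow_zero, div_one, h1, h0]
      rfl
    have hxd := den_add_one_div_two_pow hs (m := 0 + 1) (by omega)
    have hp : (0 : ℚ) < 1 / 2 ^ s := by positivity
    have hh := hhalf s
    rw [IsOrdinalSum, h1]
    refine hasValue_of_simplest ⟨_, hxd⟩ ?_ ?_ (fun _ => ?_) (fun _ => ?_)
    · rintro (i | i)
      · exact ⟨_, vl i ▸ hasValue_ofRat hv.sub_one_div_den, by rw [zero_add, hh]; linarith⟩
      · exact ⟨_, hasValue_ordinalSum_zero hv, by rw [zero_add, hh]; linarith⟩
    · rintro (i | i)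
      · refine ⟨_, vr i ▸ hasValue_ofRat (hv.add hv.one_div_den), ?_⟩
        rw [hs, zero_add, hh]
        push_cast
        linarith
      · exact i.elim
    · refine ⟨.inr (), _, hasValue_ordinalSum_zero hv, ?_⟩
      rw [hxd]
      push_cast
      linarith
    · obtain ⟨i⟩ := vrn.2 hn
      refine ⟨.inl i, _, vr i ▸ hasValue_ofRat (hv.add hv.one_div_den), ?_⟩
      rw [hxd, hs, zero_add]
      push_cast
      rw [hh]
      linarith
  | succ k ih =>
    obtain ⟨yl, yr, yln, yrn⟩ := ofRat_options (x := 1 / 2 ^ (k + 1)) ⟨_, hden _⟩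
    have e1 : (1 : ℚ) / 2 ^ (k + 1) - 1 / ((1 : ℚ) / 2 ^ (k + 1)).den = 0 := by
      rw [hden]; push_cast; ring
    have e2 : (1 : ℚ) / 2 ^ (k + 1) + 1 / ((1 : ℚ) / 2 ^ (k + 1)).den = 1 / 2 ^ k := by
      rw [hden]; push_cast; rw [hhalf]; ring
    rw [e1] at yl
    rw [e2] at yr
    have hyl : ¬ ∃ n : ℕ, (1 : ℚ) / 2 ^ (k + 1) = -n := by
      rintro ⟨n, h⟩
      have h1 : (0 : ℚ) < 1 / 2 ^ (k + 1) := by positivity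
      have h2 : (0 : ℚ) ≤ n := by positivity
      linarith
    have hyr : ¬ ∃ n : ℕ, (1 : ℚ) / 2 ^ (k + 1) = n := by
      rintro ⟨n, h⟩
      exact ne_intCast_of_den (hden (k + 1)) (by omega) n (by simpa using h)
    obtain ⟨i₀⟩ := yln.2 hyl
    obtain ⟨j₀⟩ := yrn.2 hyr
    have hxd := den_add_one_div_two_pow hs (m := k + 1 + 1) (by omega)
    have hp : (0 : ℚ) < 1 / 2 ^ (s + (k + 1)) := by positivity
    have hh := hhalf (s + (k + 1))
    have hk := hle (k + 1)
    rw [add_assoc] at hh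
    rw [IsOrdinalSum] at ih ⊢
    generalize ofRat (1 / 2 ^ (k + 1)) = Y at *
    cases Y with
    | mk l r L R =>
      have hL : ∀ i, HasValue (ordinalSum (ofRat v) (L i)) v := fun i => by
        rw [show L i = ofRat 0 from yl i]
        exact hasValue_ordinalSum_zero hv
      have hR : ∀ j, HasValue (ordinalSum (ofRat v) (R j)) (v + 1 / 2 ^ (s + (k + 1))) :=
        fun j => by
          rw [show R j = ofRat (1 / 2 ^ k) from yr j]
          exact ih
      refine hasValue_of_simplest ⟨_, hxd⟩ ?_ ?_ (fun _ => ?_) (fun _ => ?_)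
      · rintro (i | i)
        · exact ⟨_, vl i ▸ hasValue_ofRat hv.sub_one_div_den, by rw [hh]; linarith⟩
        · exact ⟨_, hL i, by rw [hh]; linarith⟩
      · rintro (i | i)
        · refine ⟨_, vr i ▸ hasValue_ofRat (hv.add hv.one_div_den), ?_⟩
          rw [hs, hh]
          push_cast
          linarith
        · exact ⟨_, hR i, by rw [hh]; linarith⟩
      · refine ⟨.inr i₀, _, hL i₀, ?_⟩
        rw [hxd]
        push_cast
        linarith
      · refine ⟨.inr j₀, _, hR j₀, ?_⟩
        rw [hxd]
        push_cast
        rw [hh]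
        linarith

end CGame

namespace FlippingCoins

/-! ### The reductions -/

theorem isEven_state (G : Line) : (state G).isEven = true ↔ Even (G.count true) := by
  induction G with
  | nil => simp [state, State.append, State.isEven]
  | cons d G ih =>
    rw [state_cons]
    cases d <;> cases hs : state G <;> rw [hs] at ih <;>
      simp_all [State.cons, State.isEven, Nat.even_add_one]

theorem state_carry {G : Line} (h : ∀ y z, state G = State.odd y z → 1 ≤ z) :
    state (false :: true :: true :: true :: G) = state (true :: false :: G) := by
  have hv := valid_state G
  simp only [state_cons]
  cases hs : state G with
  | even x =>
    rw [hs] at hv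
    simp only [State.cons, State.odd.injEq]
    refine ⟨?_, ?_⟩
    · rw [headOdd_of_one_le (by linarith [hv.1])]
      ring_nf
    · rw [headOneOdd_of_one_le (by linarith [hv.1]), ← headEven_add_three hv.1]
      ring_nf
  | odd y z =>
    simp only [State.cons, State.even.injEq]
    rw [headOneOdd_of_one_le (h y z hs), add_comm]

theorem Reduces.state_eq {G H : Line} (h : Reduces G H) : state H = state G := by
  cases h with
  | long α β j hj =>
    obtain ⟨j, rfl⟩ := Nat.exists_eq_add_of_le' hj
    have h1 : ∀ y z, state (ones (j + 1) ++ β) = State.odd y z → 1 ≤ z := by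
      intro y z h
      have hv := valid_state (ones j ++ β)
      rw [ones, List.replicate_succ, List.cons_append, state_cons] at h
      cases hs : state (ones j ++ β) with
      | even x =>
        rw [hs] at h hv
        cases h
        linarith [hv.1]
      | odd y z => rw [hs] at h; cases h
    have h2 := state_carry h1
    simp only [List.append_assoc, state_append α]
    rw [ones, ones, List.replicate_add 3]
    simpa [List.replicate_succ] using congrArg (State.append α) h2.symm
  | short α β hβ =>
    have h1 : ∀ y z, state β = State.odd y z → 1 ≤ z := by
      intro y z h
      have := (isEven_state β).2 hβ
      rw [h] at this
      cases this
    have h2 := state_carry h1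
    simp only [state_trim, List.append_assoc, state_append α]
    simpa [List.replicate_succ] using congrArg (State.append α) h2.symm

theorem length_trim_le (G : Line) : (trim G).length ≤ G.length :=
  (List.rdropWhile_prefix (p := fun d => !d) (l := G)).length_le

theorem Reduces.length_lt {G H : Line} (h : Reduces G H) : H.length < G.length := by
  cases h with
  | long α β j hj => simp; omega
  | short α β hβ =>
    refine (length_trim_le _).trans_lt ?_
    simp
    omega

theorem acc_reduces (G : Line) : Acc (fun K H => Reduces H K) G :=
  Subrelation.accessible (r := InvImage (· < ·) List.length) (fun h => h.length_lt)
    ((InvImage.wf List.length Nat.lt_wfRel.wf).apply G)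

theorem getLast?_trim {G : Line} (h : true ∈ G) : (trim G).getLast? = some true := by
  induction G using List.reverseRecOn with
  | nil => simp at h
  | append_singleton G d ih =>
    cases d
    · rw [trim, List.rdropWhile_concat_pos _ _ _ (by simp)]
      exact ih (by simpa using h)
    · rw [trim, List.rdropWhile_concat_neg _ _ _ (by simp)]
      simp

theorem Reduces.getLast?_eq {G H : Line} (h : Reduces G H) (hG : G.getLast? = some true) :
    H.getLast? = some true := by
  cases h with
  | long α β j hj =>
    obtain ⟨j, rfl⟩ := Nat.exists_eq_add_of_le' hj
    rcases List.eq_nil_or_concat β with rfl | ⟨γ, d, rfl⟩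
    · rw [List.append_nil, ones, List.replicate_succ', ← List.append_assoc, List.getLast?_concat]
    · rw [List.concat_eq_append, ← List.append_assoc, List.getLast?_concat] at hG ⊢
      exact hG
  | short α β hβ => exact getLast?_trim (by simp)

/-! ### The second phase of the algorithm -/

theorem append_zeros_odd {y z : ℚ} (h0 : 0 ≤ z) (h2 : z ≤ 2) (q : ℕ) :
    ∃ y', State.append (zeros q) (.odd y z) = .odd y' (z / 2 ^ q) := by
  induction q with
  | zero => exact ⟨y, by simp [State.append]⟩
  | succ q ih =>
    obtain ⟨y', hy'⟩ := ih
    have h3 : z / 2 ^ q ≤ 2 := (div_le_self h0 (one_le_pow₀ (by norm_num))).trans h2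
    have h4 : State.append (zeros (q + 1)) (.odd y z) =
        (State.append (zeros q) (.odd y z)).cons false := rfl
    refine ⟨headOdd y', ?_⟩
    rw [h4, hy', State.cons, headOneOdd_of_le_two (by positivity) h3, pow_succ, div_div]

theorem append_zeros_even {x : ℚ} (h0 : 0 ≤ x) (h2 : x ≤ 2) (p : ℕ) :
    State.append (zeros p) (.even x) = .even (x / 2 ^ (2 * p)) := by
  induction p with
  | zero => simp [State.append]
  | succ p ih =>
    have h3 : x / 2 ^ (2 * p) ≤ 2 := (div_le_self h0 (one_le_pow₀ (by norm_num))).trans h2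
    have h4 : State.append (zeros (p + 1)) (.even x) =
        (State.append (zeros p) (.even x)).cons false := rfl
    rw [h4, ih, State.cons, headEven_of_le_two (by positivity) h3, div_div]
    congr 2
    ring

theorem append_pair {t : ℚ} (h0 : 0 ≤ t) (h1 : t ≤ 1) (p q : ℕ) :
    State.append (zeros p ++ [true] ++ zeros q ++ [true]) (.even t) =
      .even ((1 + t) / 2 ^ (2 * p + q)) := by
  simp only [State.append_append]
  have h2 : State.append [true] (.even t) = .odd t (1 + t) := rfl
  obtain ⟨y', hy'⟩ := append_zeros_odd (y := t) (z := 1 + t) (by linarith) (by linarith) q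
  have h3 : State.append [true] (.odd y' ((1 + t) / 2 ^ q)) = .even ((1 + t) / 2 ^ q) := rfl
  have h4 : (1 + t) / 2 ^ q ≤ 2 :=
    (div_le_self (by linarith) (one_le_pow₀ (by norm_num))).trans (by linarith)
  rw [h2, hy', h3, append_zeros_even (by positivity) h4, div_div, ← pow_add, add_comm q]

theorem append_ones_even (u : ℚ) (k : ℕ) :
    State.append (ones (2 * k)) (.even u) = .even (k + u) := by
  induction k with
  | zero => simp [State.append]
  | succ k ih =>
    have h : State.append (ones (2 * (k + 1))) (.even u) =
        ((State.append (ones (2 * k)) (.even u)).cons true).cons true := rfl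
    rw [h, ih]
    simp only [State.cons, State.even.injEq]
    push_cast
    ring

theorem val_append_ones (u : ℚ) (a : ℕ) :
    (State.append (ones a) (.even u)).val = (a / 2 : ℕ) + u := by
  rcases Nat.even_or_odd' a with ⟨k, rfl | rfl⟩
  · rw [append_ones_even, Nat.mul_div_cancel_left _ (by norm_num)]
    rfl
  · have h : State.append (ones (2 * k + 1)) (.even u) =
        (State.append (ones (2 * k)) (.even u)).cons true := rfl
    rw [h, append_ones_even, show (2 * k + 1) / 2 = k by omega]
    rfl

theorem val_append_zeros_true {t : ℚ} (h1 : t ≤ 1) (r : ℕ) :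
    (State.append (zeros r ++ [true]) (.even t)).val = t - r := by
  suffices h : ∃ z, State.append (zeros r ++ [true]) (.even t) = .odd (t - r) z by
    obtain ⟨z, hz⟩ := h
    rw [hz]
    rfl
  induction r with
  | zero => exact ⟨1 + t, by simp [State.append, State.cons]⟩
  | succ r ih =>
    obtain ⟨z, hz⟩ := ih
    have h : State.append (zeros (r + 1) ++ [true]) (.even t) =
        (State.append (zeros r ++ [true]) (.even t)).cons false := rfl
    have hr : (0 : ℚ) ≤ r := by positivity
    refine ⟨headOneOdd z, ?_⟩
    rw [h, hz, State.cons, headOdd_of_le_one (by linarith)]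
    congr 1
    push_cast
    ring

/-- The result of the second phase, and its dependence on further coins at the right end. -/
theorem Evaluates.affine {G : Line} {v : ℚ} (h : Evaluates G v) :
    (∃ s : ℕ, v.den = 2 ^ s ∧
      ∀ t : ℚ, 0 ≤ t → t ≤ 1 → (State.append G (.even t)).val = v + t / 2 ^ s) ∧
    (false ∈ G → ¬ ∃ n : ℕ, v = n) := by
  induction h with
  | oneTail r =>
    refine ⟨⟨0, ?_, fun t _ h1 => ?_⟩, ?_⟩
    · simp
    · rw [val_append_zeros_true h1]
      ring
    · rintro h ⟨n, hn⟩
      have hr : r ≠ 0 := by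
        rintro rfl
        simp at h
      have h1 : (0 : ℚ) ≤ n := by positivity
      have h2 : (0 : ℚ) < r := by exact_mod_cast Nat.pos_of_ne_zero hr
      linarith
  | base a p q =>
    have hden : (((a / 2 : ℕ) : ℚ) + 1 / 2 ^ (2 * p + q)).den = 2 ^ (2 * p + q) := by
      rcases Nat.eq_zero_or_pos (2 * p + q) with h0 | h0
      · rw [h0, pow_zero, pow_zero, div_one]
        exact_mod_cast Rat.den_natCast (a / 2 + 1)
      · have := CGame.den_add_one_div_two_pow (x := ((a / 2 : ℕ) : ℚ)) (s := 0)
          (by rw [pow_zero]; exact Rat.den_natCast _) h0.ne'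
        rwa [zero_add] at this
    refine ⟨⟨2 * p + q, hden, fun t h0 h1 => ?_⟩, ?_⟩
    · have := append_pair h0 h1 p q
      simp only [State.append_append] at this ⊢
      rw [this, val_append_ones]
      ring
    · rintro h ⟨n, hn⟩
      refine CGame.ne_intCast_of_den hden ?_ n (by simpa using hn)
      rintro h0
      obtain ⟨rfl, rfl⟩ : p = 0 ∧ q = 0 := by omega
      simp at h
  | split α a p q v w ha hpq _ hw ih =>
    obtain ⟨⟨s, hs, ht⟩, hn⟩ := ih
    have hw' := CGame.HasValue.unique hw
      (CGame.isOrdinalSum_one_div_two_pow hs (hn (by simp)) (2 * p + q - 1))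
    rw [show 2 * p + q - 1 + 1 = 2 * p + q by omega] at hw'
    have hden := CGame.den_add_one_div_two_pow hs (m := 2 * p + q) (by omega)
    rw [← hw'] at hden
    refine ⟨⟨s + (2 * p + q), hden, fun t h0 h1 => ?_⟩, ?_⟩
    · have h2 := append_pair h0 h1 p q
      have h3 : (1 + t) / 2 ^ (2 * p + q) ≤ 1 := by
        rw [div_le_one (by positivity)]
        calc 1 + t ≤ 2 ^ 1 := by linarith
          _ ≤ 2 ^ (2 * p + q) := pow_le_pow_right₀ (by norm_num) (by omega)
      have h4 := ht _ (by positivity) h3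
      simp only [State.append_append] at h2 h4 ⊢
      rw [h2, h4, hw', pow_add]
      field_simp
      ring
    · rintro - ⟨n, hn⟩
      exact CGame.ne_intCast_of_den hden (by omega) n (by simpa using hn)

theorem Evaluates.eq_value {G : Line} {v : ℚ} (h : Evaluates G v) : v = value G := by
  obtain ⟨⟨s, -, ht⟩, -⟩ := h.affine
  have := ht 0 le_rfl zero_le_one
  rw [zero_div, add_zero] at this
  exact this.symm

theorem eq_zeros_of_not_mem {G : Line} (h : true ∉ G) : ∃ r, G = zeros r :=
  ⟨G.length, List.eq_replicate_iff.2 ⟨rfl, fun b hb => by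
    cases b
    · rfl
    · exact absurd hb h⟩⟩

theorem eq_ones_of_not_mem {G : Line} (h : false ∉ G) : ∃ r, G = ones r :=
  ⟨G.length, List.eq_replicate_iff.2 ⟨rfl, fun b hb => by
    cases b
    · exact absurd hb h
    · rfl⟩⟩

theorem exists_append_last {G : Line} {b : Bool} (h : b ∈ G) :
    ∃ (H : Line) (n : ℕ), G = H ++ [b] ++ List.replicate n (!b) := by
  induction G using List.reverseRecOn with
  | nil => simp at h
  | append_singleton G d ih =>
    by_cases hd : d = b
    · exact ⟨G, 0, by simp [hd]⟩
    · obtain ⟨H, n, hH⟩ := ih (by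
        rcases List.mem_append.1 h with h | h
        · exact h
        · exact absurd (List.mem_singleton.1 h).symm hd)
      refine ⟨H, n + 1, ?_⟩
      have hd' : d = !b := by cases d <;> cases b <;> simp_all
      rw [hH, hd', List.replicate_succ', List.append_assoc (H ++ [b])]

theorem Reduces.exists_append {G H T : Line} (h : Reduces G H) (hT : Even (T.count true)) :
    ∃ K, Reduces (G ++ T) K := by
  cases h with
  | long α β j hj =>
    rw [List.append_assoc]
    exact ⟨_, .long α (β ++ T) j hj⟩
  | short α β hβ =>
    rw [List.append_assoc]
    exact ⟨_, .short α (β ++ T) (by rw [List.count_append]; exact hβ.add hT)⟩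

theorem exists_evaluates (G : Line) (hG : G.getLast? = some true)
    (hred : ¬ ∃ K, Reduces G K) : ∃ v, Evaluates G v := by
  induction hn : G.length using Nat.strong_induction_on generalizing G with
  | _ n ih =>
    obtain ⟨L, rfl⟩ := List.getLast?_eq_some_iff.1 hG
    by_cases hL : true ∈ L
    swap
    · obtain ⟨r, rfl⟩ := eq_zeros_of_not_mem hL
      exact ⟨_, .oneTail r⟩
    obtain ⟨M, q, rfl⟩ := exists_append_last hL
    by_cases hM : true ∈ M
    swap
    · obtain ⟨p, rfl⟩ := eq_zeros_of_not_mem hM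
      exact ⟨_, .base 0 p q⟩
    obtain ⟨N, p, rfl⟩ := exists_append_last hM
    by_cases hN : false ∈ N ++ [true]
    swap
    · obtain ⟨a, ha⟩ := eq_ones_of_not_mem hN
      rw [ha]
      exact ⟨_, .base a p q⟩
    obtain ⟨α, a, ha⟩ := exists_append_last hN
    have ha0 : 0 < a := by
      refine Nat.pos_of_ne_zero ?_
      rintro rfl
      have := congrArg List.getLast? ha
      simp at this
    rw [ha] at hred hn ⊢
    simp only [Bool.not_false, Bool.not_true] at hred hn ⊢
    have hpq : 1 ≤ p + q := by
      by_contra hpq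
      obtain ⟨rfl, rfl⟩ : p = 0 ∧ q = 0 := by omega
      have e : α ++ [false] ++ ones a ++ zeros 0 ++ [true] ++ zeros 0 ++ [true] = α ++ [false] ++ ones (a + 1 + 1) ++ [] := by
        simp [ones, List.replicate_succ']
      rw [e] at hred
      rcases Nat.lt_or_ge 1 a with h | h
      · obtain ⟨j, rfl⟩ := Nat.exists_eq_add_of_le h
        rw [show Nat.succ 1 + j + 1 + 1 = 3 + (j + 1) by omega] at hred
        exact hred ⟨_, .long α [] (j + 1) (by omega)⟩
      · obtain rfl : a = 1 := by omega
        exact hred ⟨_, .short α [] (by simp)⟩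
    obtain ⟨v, hv⟩ := ih (α ++ [false] ++ ones a).length (by
        rw [← hn]
        simp only [List.length_append, List.length_cons, List.length_nil, List.length_replicate]
        omega) (α ++ [false] ++ ones a) (by
        have : (α ++ [false] ++ ones a) = N ++ [true] := ha.symm
        rw [this]
        simp) (by
        rintro ⟨K, hK⟩
        refine hred ?_
        have := hK.exists_append (T := zeros p ++ [true] ++ zeros q ++ [true])
          (by simp [List.count_replicate])
        simpa only [List.append_assoc] using this) rfl
    obtain ⟨⟨s, hs, -⟩, hnat⟩ := hv.affine
    exact ⟨_, .split α a p q v _ ha0 hpq hv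
      (CGame.isOrdinalSum_one_div_two_pow hs (hnat (by simp)) _)⟩

theorem algorithmReturns_value {G : Line} (hG : G.getLast? = some true) :
    AlgorithmReturns G (value G) := by
  refine ⟨acc_reduces G, fun H hGH' w => ?_⟩
  obtain ⟨hGH, hH⟩ := hGH'
  obtain ⟨hlast, hstate⟩ : H.getLast? = some true ∧ state H = state G := by
    clear hH
    induction hGH with
    | refl => exact ⟨hG, rfl⟩
    | tail _ h ih => exact ⟨h.getLast?_eq ih.1, h.state_eq.trans ih.2⟩
  have hval : value H = value G := by rw [value, hstate, value]
  rw [← hval]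
  refine ⟨Evaluates.eq_value, ?_⟩
  rintro rfl
  obtain ⟨v, hv⟩ := exists_evaluates H hlast hH
  rwa [← hv.eq_value]

end FlippingCoins

theorem mainTheorem1 (G : FlippingCoins.Line) (hG : FlippingCoins.IsPosition G)
    (h1 : true ∈ G) :
    ∃ v₀ : ℚ, FlippingCoins.AlgorithmReturns G v₀ ∧
      CGame.HasValue (FlippingCoins.game G) v₀ := by
  refine ⟨FlippingCoins.value G, FlippingCoins.algorithmReturns_value ?_,
    FlippingCoins.hasValue_game G⟩
  have h := FlippingCoins.getLast?_trim h1
  rwa [hG] at h
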